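/- A quaternion algebra $D$ over a number field $k$ is called admissible if $k$ has at most one complex place and $D\otimes_k k_\nu\cong M_2(k_\nu)$ for exactly one infinite place $\nu$ of $k$. Put $\mathrm{PD}^\times(k)=D^\times/k^\times$. For $\gamma\in \mathrm{PD}^\times(k)$ with a lift $\tilde\gamma\in D^\times$, the eigenvalues of the conjugation $\mathrm{Ad}\,\gamma\colon x\mapsto\tilde\gamma x\tilde\gamma^{-1}$ on $D$, with multiplicity, are $1,1,\lambda,\lambda^{-1}$ for some $\lambda\in\overline{k}$. Let $m(\gamma)=m(\lambda)=m(\lambda^{-1})$ be the logarithmic Mahler measure of $\lambda$, where for an algebraic number $\alpha$ $$m(\alpha)=\sum_{\nu}\log^+|\alpha|_\nu ,$$ the sum being over all (finite and infinite) places $\nu$ of $\mathbb{Q}(\alpha)$ with normalized absolute values, and $\log^+t=\max\{\log t,0\}$. Theorem. For every $R>0$ there is a constant $C=C(R)>0$ such that for every number field $k$ and every admissible quaternion algebra $D$ over $k$, the number of conjugacy classes $[\gamma]$ in $\mathrm{PD}^\times(k)$ of elements $\gamma$ which are not of order $2$ and satisfy $m(\gamma)\le R$ is finite and at most $$C\exp\left(C\,(\log[k:\mathbb{Q}])^2\right).$$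 -/

import Mathlib

open scoped TensorProduct Quaternion Real

noncomputable section

namespace QuatConj

/-- `D` is a quaternion algebra over `k`: `D ≅ (a, b / k)` for some `a, b ∈ kˣ`, i.e. it has a basis
`1, i, j, ij` with `i² = a`, `j² = b`, `ij = -ji`. -/
def IsQuaternionAlgebra (k D : Type*) [Field k] [Ring D] [Algebra k D] : Prop :=
  ∃ a b : k, a ≠ 0 ∧ b ≠ 0 ∧ Nonempty (D ≃ₐ[k] ℍ[k, a, 0, b])

/-- `D` splits at the infinite place `v` of `k`: `k_v ⊗ D ≅ M(2, k_v)`. -/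
def SplitsAt {k : Type*} (D : Type*) [Field k] [Ring D] [Algebra k D]
    (v : NumberField.InfinitePlace k) : Prop :=
  Nonempty ((v.Completion ⊗[k] D) ≃ₐ[v.Completion] Matrix (Fin 2) (Fin 2) v.Completion)

/-- `D` is an admissible quaternion algebra over the number field `k`: `k` has at most one complex
place and `D` splits at exactly one infinite place of `k`. It is `𝕂`-admissible for
`𝕂 = ℝ` or `𝕂 = ℂ`, the completion of `k` at that place. -/
structure IsAdmissible (k D : Type*) [Field k] [NumberField k] [Ring D] [Algebra k D] : Prop where
  isQuaternionAlgebra : IsQuaternionAlgebra k D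
  complexPlaces_le_one : NumberField.InfinitePlace.nrComplexPlaces k ≤ 1
  existsUnique_splitsAt : ∃! v : NumberField.InfinitePlace k, SplitsAt D v

/-- The subgroup `kˣ` of scalars in `Dˣ`. -/
def scalars (k D : Type*) [Field k] [Ring D] [Algebra k D] : Subgroup Dˣ :=
  (Units.map (algebraMap k D : k →* D)).range

theorem scalars_comm {k D : Type*} [Field k] [Ring D] [Algebra k D] {g : Dˣ}
    (hg : g ∈ scalars k D) (x : D) : (g : D) * x = x * g := by
  obtain ⟨c, rfl⟩ := hg
  exact Algebra.commutes (c : k) x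

instance scalars_normal (k D : Type*) [Field k] [Ring D] [Algebra k D] :
    (scalars k D).Normal where
  conj_mem n hn g := by
    have h : g * n * g⁻¹ = n := by
      rw [mul_inv_eq_iff_eq_mul]
      exact Units.ext (scalars_comm hn g).symm
    rwa [h]

/-- The group `PDˣ(k) = Dˣ / kˣ`. -/
abbrev PD (k D : Type*) [Field k] [Ring D] [Algebra k D] : Type _ := Dˣ ⧸ scalars k D

/-- The conjugation action of `Dˣ` on `D`, `g ↦ (x ↦ g x g⁻¹)`. -/
def conjEnd (k D : Type*) [Field k] [Ring D] [Algebra k D] : Dˣ →* Module.End k D where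
  toFun g := LinearMap.mulLeft k (g : D) * LinearMap.mulRight k ((g⁻¹ : Dˣ) : D)
  map_one' := by ext; simp
  map_mul' g h := by ext; simp [mul_assoc]

/-- The adjoint action `Ad` of `PDˣ(k)` on `D` by conjugation. As a representation,
`D` is the sum of the line of scalars, with trivial action, and the Lie algebra of `PDˣ`. -/
def Ad (k D : Type*) [Field k] [Ring D] [Algebra k D] : PD k D →* Module.End k D :=
  QuotientGroup.lift (scalars k D) (conjEnd k D) fun g hg => by
    ext x
    simp [conjEnd, ← mul_assoc, scalars_comm hg x]

/-- `μ` is one of the two non-trivial eigenvalues of `Ad γ`: for `γ` in `PDˣ(k)` with `D` a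
quaternion algebra, the eigenvalues of `Ad γ` on the 4-dimensional space `D`, with multiplicity, are
`1, 1, μ, μ⁻¹` with `μ` in an algebraic closure of `k` (`μ = 1` may occur). -/
def IsNontrivialEigenvalue {k D : Type*} [Field k] [Ring D] [Algebra k D] [Module.Finite k D]
    (γ : PD k D) (μ : AlgebraicClosure k) : Prop :=
  ∃ μ' : AlgebraicClosure k,
    (LinearMap.charpoly (Ad k D γ)).aroots (AlgebraicClosure k) = {1, 1, μ, μ'}

theorem isAlgebraic_algebraicClosure (k : Type*) [Field k] [NumberField k] :
    Algebra.IsAlgebraic ℚ (AlgebraicClosure k) :=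
  Algebra.IsAlgebraic.trans ℚ k (AlgebraicClosure k)

theorem numberField_adjoin {k : Type*} [Field k] [NumberField k] (α : AlgebraicClosure k) :
    NumberField (IntermediateField.adjoin ℚ {α}) := by
  have := isAlgebraic_algebraicClosure k
  have : FiniteDimensional ℚ (IntermediateField.adjoin ℚ {α}) :=
    IntermediateField.adjoin.finiteDimensional (Algebra.IsIntegral.isIntegral α)
  exact {}

/-- The sum of `log⁺ |x|_ν` over all places `ν` of the number field `K`, finite and infinite, where
`|·|_ν` are the normalized absolute values (the square of the usual one for `ν` complex). -/
def sumPosLog {K : Type*} [Field K] [NumberField K] (x : K) : ℝ :=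
  (∑ v : NumberField.InfinitePlace K, (v.mult : ℝ) * log⁺ (v x)) +
    ∑ᶠ v : NumberField.FinitePlace K, log⁺ (v x)

/-- The logarithmic Mahler measure of an algebraic number `α`: the sum of `log⁺ |α|_ν` over all places
`ν` of the number field `ℚ(α)`. -/
def logMahler {k : Type*} [Field k] [NumberField k] (α : AlgebraicClosure k) : ℝ :=
  haveI := numberField_adjoin α
  sumPosLog (IntermediateField.AdjoinSimple.gen ℚ α)

/-- The conjugacy classes `[γ]` in `PDˣ(k)`, with `γ` not of order two, such that `m(γ) ≤ R`, where
`m(γ)` is the logarithmic Mahler measure of a non-trivial eigenvalue of `Ad γ`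
(the two non-trivial eigenvalues are mutually inverse and have the same measure). -/
def boundedClasses (k D : Type*) [Field k] [NumberField k] [Ring D] [Algebra k D]
    [Module.Finite k D] (R : ℝ) : Set (ConjClasses (PD k D)) :=
  {c | ∃ γ : PD k D, ConjClasses.mk γ = c ∧ orderOf γ ≠ 2 ∧
    ∃ μ : AlgebraicClosure k, IsNontrivialEigenvalue γ μ ∧ logMahler μ ≤ R}

end QuatConj

end

noncomputable section

namespace QuatConj

open NumberField

/-! Write `D = (a, b / k)`, let `q` be the image of a lift of `γ`, and let `t = λ + λ⁻¹`. Then `t =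
4 (re q)² / nr q - 2` lies in `k`. If `γ` is neither trivial nor of order two, `t` determines its
conjugacy class: one rescales lifts to equal real parts, and then their norms agree
(`isConj_of_eigenTrace_eq`). So it suffices to count the values of `t`. At a real place where `D`
does not split the norm form is positive definite, hence `t ∈ [-2, 2]` and `|λ| = 1`
(`eigenTrace_mem_Icc`). Admissibility leaves at most four exceptional embeddings of `k`
(`card_noncompactEmbeddings_le`).

The values `t` are sorted by the field `l = ℚ(t)`. With `d = [k : ℚ]` there are at most `d ^ log₂ d`
choices of `l` (`card_intermediateField_le`), which is already `exp(O((log d)²))`. The values for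
which `λ` is a root of unity are `O(d⁴)` in number and are counted separately.

Fix `l` of degree `n`, and let `t = x + x⁻¹` and `s = y + y⁻¹` both generate `l`. As `ℚ(x)` has
degree at least `n`, the absolute heights of `x` and `y` are at most `R / n`. Unless `xy` or `x/y`
is a root of unity, both are points of small height with almost all conjugates on the unit circle. A
quantitative form of Bilu's theorem (`sq_norm_sum_embeddings_le`) shows that the mean of their
conjugates there is `O(√(log n / n))`. It follows by comparing the energy of a logarithmic kernel
with the product formula applied to differences of conjugates. On the circle `ts = 2 Re(xy) + 2
Re(x/y)`, so the vectors `(Re σ(t) / √n)_σ` are of length at least 1, and each is almost orthogonal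
to all but `O(n⁴)` of the others (`gram_estimates`, `card_exceptional_le`).

In dimension `n`, vectors with squared inner products `O(log n / n)` can still be numerous. Passing
to `p`-th symmetric tensor powers with `p` of order `log n` makes the inner products small against
the dimension of the tensor space. The trace inequality then bounds the family by `exp(O((log n)²))`
(`card_le_of_almost_orthogonal`, `exists_power_of_log`). Bounded `n` is covered by Northcott's
theorem (`exists_finite_of_height_le`). -/

/-- The finite part of the multiplicative height. -/
def finHeight {K : Type*} [Field K] [NumberField K] (x : K) : ℝ :=
  ∏ᶠ v : FinitePlace K, max (v x) 1

/-! ### Finite part of the height and ideal norms. -/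

section FinHeight

variable {K : Type*} [Field K] [NumberField K]

theorem hasFiniteMulSupport_max_one (x : K) :
    (fun v : FinitePlace K => max (v x) 1).HasFiniteMulSupport := by
  rcases eq_or_ne x 0 with rfl | hx
  · have : (fun v : FinitePlace K => max (v (0 : K)) 1) = fun _ => 1 := by
      ext v; simp
    rw [this]
    simp [Function.HasFiniteMulSupport]
  · refine (FinitePlace.hasFiniteMulSupport hx).subset ?_
    intro v hv
    simp only [Function.mem_mulSupport] at hv ⊢
    intro h
    exact hv (by simp [h])

theorem iSup_fin_two (f : Fin 2 → ℝ) : ⨆ i, f i = max (f 0) (f 1) := by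
  apply le_antisymm
  · exact ciSup_le fun i => by fin_cases i <;> simp
  · exact max_le (le_ciSup (Finite.bddAbove_range f) 0) (le_ciSup (Finite.bddAbove_range f) 1)

/-- The finite part of the height of `a / b` is the index of `(b)` in `(a, b)`. This makes it an
integer and gives its behaviour under field extension. -/
theorem finHeight_div_mul_absNorm (a b : 𝓞 K) (hb : b ≠ 0) :
    finHeight ((a : K) / b) * (Ideal.span {a, b}).absNorm = (Ideal.span {b}).absNorm := by
  have hbK : (b : K) ≠ 0 := RingOfIntegers.coe_ne_zero_iff.mpr hb
  have h1 := absNorm_mul_finprod_finitePlace_eq_one (K := K) (x := ![a, b])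
    (by intro h; exact hb (by simpa using congrFun h 1))
  have h2 : ∏ᶠ v : FinitePlace K, v (b : K) = ((Ideal.span {b}).absNorm : ℝ)⁻¹ := by
    rw [FinitePlace.prod_eq_inv_abs_norm_int hb, Ideal.absNorm_span_singleton]
    simp [Nat.cast_natAbs]
  have h3 : ∏ᶠ v : FinitePlace K, ⨆ i, v (![a, b] i : K)
      = finHeight ((a : K) / b) * ∏ᶠ v : FinitePlace K, v (b : K) := by
    rw [finHeight, ← finprod_mul_distrib (hasFiniteMulSupport_max_one _)
      (FinitePlace.hasFiniteMulSupport hbK)]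
    refine finprod_congr fun v => ?_
    have hv : 0 < v (b : K) := FinitePlace.pos_iff.mpr hbK
    rw [iSup_fin_two, max_mul_of_nonneg _ _ hv.le, map_div₀]
    simp [div_mul_cancel₀ _ hv.ne']
  rw [h3, h2] at h1
  have hN : ((Ideal.span {b}).absNorm : ℝ) ≠ 0 := by
    simp [hb]
  have h4 : Set.range ![a, b] = {a, b} := by simp [Set.pair_comm]
  rw [h4] at h1
  field_simp at h1
  linarith

theorem exists_div_eq (x : K) : ∃ a b : 𝓞 K, b ≠ 0 ∧ x = (a : K) / b := by
  obtain ⟨a, b, hb, rfl⟩ := IsFractionRing.div_surjective (A := 𝓞 K) x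
  exact ⟨a, b, nonZeroDivisors.ne_zero hb, rfl⟩

theorem absNorm_span_pair_pos (a : 𝓞 K) {b : 𝓞 K} (hb : b ≠ 0) :
    0 < (Ideal.span {a, b}).absNorm := by
  rw [Nat.pos_iff_ne_zero, Ne, Ideal.absNorm_eq_zero_iff, Ideal.span_eq_bot]
  intro h
  exact hb (h b (by simp))

theorem one_le_finHeight (x : K) : 1 ≤ finHeight x :=
  one_le_finprod fun _ => le_max_right _ _

theorem finHeight_pos (x : K) : 0 < finHeight x := zero_lt_one.trans_le (one_le_finHeight x)

/-- The value is a positive integer, and it equals 1 only if `(a, b) = (b)`, that is, if `b` divides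
`a`. -/
theorem two_le_finHeight {x : K} (hx : ¬ IsIntegral ℤ x) : 2 ≤ finHeight x := by
  obtain ⟨a, b, hb, rfl⟩ := exists_div_eq x
  have h := finHeight_div_mul_absNorm a b hb
  have hle : Ideal.span {b} ≤ Ideal.span {a, b} := Ideal.span_mono (by simp)
  obtain ⟨c, hc⟩ := Ideal.absNorm_dvd_absNorm_of_le hle
  have hpos := absNorm_span_pair_pos a hb
  have hcf : finHeight ((a : K) / b) = c := by
    rw [hc, Nat.cast_mul, mul_comm] at h
    exact mul_left_cancel₀ (by exact_mod_cast hpos.ne') h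
  have h1 := one_le_finHeight ((a : K) / b)
  rw [hcf] at h1 ⊢
  have h2 : c ≠ 1 := by
    rintro rfl
    rw [mul_one] at hc
    have hne : Ideal.span {b} ≠ ⊥ := by simpa using hb
    have heq : Ideal.span {a, b} = Ideal.span {b} := by
      have hbot : Ideal.span {a, b} ≠ ⊥ := fun h => hne (le_bot_iff.mp (h ▸ hle))
      obtain ⟨J, hJ⟩ := Ideal.dvd_iff_le.mpr hle
      have : Ideal.absNorm J = 1 := by
        have := congrArg Ideal.absNorm hJ
        rw [map_mul, hc] at this
        exact (Nat.eq_of_mul_eq_mul_left hpos (by rw [mul_one]; exact this)).symm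
      rw [Ideal.absNorm_eq_one_iff] at this
      rw [hJ, this, Ideal.mul_top]
    have ha : a ∈ Ideal.span {b} := heq ▸ Ideal.subset_span (by simp)
    obtain ⟨q, rfl⟩ := Ideal.mem_span_singleton'.mp ha
    apply hx
    have hbK : (b : K) ≠ 0 := RingOfIntegers.coe_ne_zero_iff.mpr hb
    rw [show ((q * b : 𝓞 K) : K) = q * b from map_mul _ _ _, mul_div_cancel_right₀ _ hbK]
    exact q.isIntegral_coe
  have : (1 : ℕ) ≤ c := by exact_mod_cast h1
  exact_mod_cast (by omega : 2 ≤ c)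

theorem finHeight_algebraMap {L : Type*} [Field L] [NumberField L] [Algebra K L] (x : K) :
    finHeight (algebraMap K L x) = finHeight x ^ Module.finrank K L := by
  obtain ⟨a, b, hb, rfl⟩ := exists_div_eq x
  have hb' : algebraMap (𝓞 K) (𝓞 L) b ≠ 0 := by
    rw [Ne, FaithfulSMul.algebraMap_eq_zero_iff]; exact hb
  have h1 := finHeight_div_mul_absNorm a b hb
  have h2 := finHeight_div_mul_absNorm (algebraMap (𝓞 K) (𝓞 L) a) (algebraMap (𝓞 K) (𝓞 L) b) hb'
  have hfr : Module.finrank (𝓞 K) (𝓞 L) = Module.finrank K L :=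
    (IsFractionRing.finrank_eq (𝓞 K) K (𝓞 L) L).symm
  have h3 := Ideal.absNorm_algebraMap (S := 𝓞 L) (I := Ideal.span {a, b})
  have h4 := Ideal.absNorm_algebraMap (S := 𝓞 L) (I := Ideal.span {b})
  rw [Ideal.map_span, Set.image_pair, hfr] at h3
  rw [Ideal.map_span, Set.image_singleton, hfr] at h4
  rw [h3, h4] at h2
  push_cast at h2
  rw [← h1, mul_pow] at h2
  have hpos : ((Ideal.span {a, b}).absNorm : ℝ) ^ Module.finrank K L ≠ 0 := by
    have := absNorm_span_pair_pos a hb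
    positivity
  have h5 := mul_right_cancel₀ hpos h2
  rw [← h5]
  simp only [map_div₀]
  rfl

theorem finHeight_ringHom {L : Type*} [Field L] [NumberField L] (φ : K →+* L) (x : K) :
    finHeight (φ x) ^ Module.finrank ℚ K = finHeight x ^ Module.finrank ℚ L := by
  let := φ.toAlgebra
  have h := finHeight_algebraMap (L := L) x
  rw [RingHom.algebraMap_toAlgebra] at h
  rw [h, ← pow_mul, mul_comm, Module.finrank_mul_finrank]

theorem logHeight₁_eq_add (x : K) :
    Height.logHeight₁ x = (∑ v : InfinitePlace K, (v.mult : ℝ) * log⁺ (v x))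
      + Real.log (finHeight x) := by
  rw [Height.logHeight₁_eq_log_mulHeight₁, NumberField.mulHeight₁_eq, Real.log_mul]
  · congr 1
    rw [Real.log_prod (fun v _ => by positivity)]
    refine Finset.sum_congr rfl fun v _ => ?_
    rw [Real.log_pow, Real.posLog_eq_log_max_one (by positivity), max_comm]
  · exact Finset.prod_ne_zero_iff.mpr fun v _ => by positivity
  · exact (finHeight_pos x).ne'

theorem sumPosLog_eq (x : K) : sumPosLog x = Height.logHeight₁ x :=
  (NumberField.logHeight₁_eq x).symm

theorem log_finHeight_nonneg (x : K) : 0 ≤ Real.log (finHeight x) :=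
  Real.log_nonneg (one_le_finHeight x)

/-- Ultrametric inequality at each place: `|x - y| ≤ max(|x|, |y|) ≤ max(|x|, 1) max(|y|, 1)`. -/
theorem finprod_sub_le {x y : K} (h : x ≠ y) :
    ∏ᶠ v : FinitePlace K, v (x - y) ≤ finHeight x * finHeight y := by
  rw [finHeight, finHeight, ← finprod_mul_distrib (hasFiniteMulSupport_max_one x)
    (hasFiniteMulSupport_max_one y)]
  refine finprod_le_finprod (FinitePlace.hasFiniteMulSupport (sub_ne_zero.mpr h))
    (fun v => apply_nonneg v _) ?_ ?_
  · exact (hasFiniteMulSupport_max_one x).mul (hasFiniteMulSupport_max_one y)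
  · intro v
    have hv : v (x - y) ≤ max (v x) (v y) := by
      have := FinitePlace.add_le v x (-y)
      rwa [← sub_eq_add_neg, map_neg_eq_map] at this
    refine hv.trans (max_le ?_ ?_)
    · exact (le_max_left _ _).trans (le_mul_of_one_le_right (by positivity) (le_max_right _ _))
    · exact (le_max_left _ _).trans (le_mul_of_one_le_left (by positivity) (le_max_right _ _))

end FinHeight

/-! ### Heights as sums over complex embeddings. -/

/-- `∑` over infinite places as a sum over embeddings. -/
theorem sum_infinitePlace_eq {K : Type*} [Field K] [NumberField K] (f : ℝ → ℝ) (x : K) :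
    ∑ v : InfinitePlace K, (v.mult : ℝ) * f (v x) = ∑ τ : K →+* ℂ, f ‖τ x‖ := by
  classical
  rw [← Finset.sum_fiberwise_of_maps_to (s := Finset.univ) (t := Finset.univ)
    (g := fun τ : K →+* ℂ => InfinitePlace.mk τ) (fun _ _ => Finset.mem_univ _)]
  refine Finset.sum_congr rfl fun v _ => ?_
  rw [← InfinitePlace.card_filter_mk_eq, ← nsmul_eq_mul, ← Finset.sum_const]
  refine Finset.sum_congr rfl fun τ hτ => ?_
  rw [← (Finset.mem_filter.mp hτ).2, InfinitePlace.apply]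

theorem logHeight₁_eq_sum_embeddings {K : Type*} [Field K] [NumberField K] (x : K) :
    Height.logHeight₁ x = (∑ τ : K →+* ℂ, log⁺ ‖τ x‖) + Real.log (finHeight x) := by
  rw [logHeight₁_eq_add, sum_infinitePlace_eq]

open scoped Classical in
/-- The number of extensions of an embedding. -/
theorem card_extensions {K L : Type*} [Field K] [NumberField K] [Field L] [NumberField L]
    [Algebra K L] (σ : K →+* ℂ) :
    (Finset.univ.filter fun τ : L →+* ℂ => τ.comp (algebraMap K L) = σ).card
      = Module.finrank K L := by
  let := σ.toAlgebra
  rw [← AlgHom.card K L ℂ, ← Finset.card_univ]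
  refine (Finset.card_bij (fun (τ : L →ₐ[K] ℂ) _ => (τ : L →+* ℂ)) ?_ ?_ ?_).symm
  · intro τ _
    simp only [Finset.mem_filter, Finset.mem_univ, true_and]
    exact τ.comp_algebraMap
  · intro τ _ τ' _ h
    exact AlgHom.coe_ringHom_injective h
  · intro τ hτ
    simp only [Finset.mem_filter, Finset.mem_univ, true_and] at hτ
    exact ⟨⟨τ, fun x => RingHom.congr_fun hτ x⟩, Finset.mem_univ _, rfl⟩

theorem sum_comp_algebraMap {K L : Type*} [Field K] [NumberField K] [Field L] [NumberField L]
    [Algebra K L] (f : (K →+* ℂ) → ℝ) :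
    ∑ τ : L →+* ℂ, f (τ.comp (algebraMap K L)) = Module.finrank K L * ∑ σ : K →+* ℂ, f σ := by
  classical
  rw [← Finset.sum_fiberwise_of_maps_to (s := Finset.univ) (t := Finset.univ)
    (g := fun τ : L →+* ℂ => τ.comp (algebraMap K L)) (fun _ _ => Finset.mem_univ _),
    Finset.mul_sum]
  refine Finset.sum_congr rfl fun σ _ => ?_
  rw [← card_extensions (L := L) σ, ← nsmul_eq_mul, ← Finset.sum_const]
  refine Finset.sum_congr (by ext; simp) fun τ hτ => ?_
  rw [(Finset.mem_filter.mp hτ).2]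

/-- The height relative to `L`, normalised, does not depend on `L`. -/
theorem logHeight₁_algebraMap {K L : Type*} [Field K] [NumberField K] [Field L] [NumberField L]
    [Algebra K L] (x : K) :
    Height.logHeight₁ (algebraMap K L x) = Module.finrank K L * Height.logHeight₁ x := by
  rw [logHeight₁_eq_sum_embeddings, logHeight₁_eq_sum_embeddings, finHeight_algebraMap,
    Real.log_pow, mul_add, ← sum_comp_algebraMap]
  rfl

/-! ### Quantitative equidistribution of points of small height. -/

/-- The logarithmic kernel is positive definite with Fourier coefficients `ρ ^ k / k`. -/
theorem sq_norm_sum_le_energy {ι : Type*} (G : Finset ι) (z : ι → ℂ) (hz : ∀ i ∈ G, ‖z i‖ = 1)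
    {ρ : ℝ} (h0 : 0 ≤ ρ) (h1 : ρ < 1) :
    ρ * ‖∑ i ∈ G, z i‖ ^ 2 ≤
      ∑ i ∈ G, ∑ j ∈ G, -Real.log ‖1 - ρ * (z i * (starRingEnd ℂ) (z j))‖ := by
  have hs : ∀ i ∈ G, ∀ j ∈ G, HasSum
      (fun k : ℕ => ((ρ * (z i * (starRingEnd ℂ) (z j))) ^ k / k).re)
      (-Real.log ‖1 - ρ * (z i * (starRingEnd ℂ) (z j))‖) := by
    intro i hi j hj
    have hn : ‖(ρ : ℂ) * (z i * (starRingEnd ℂ) (z j))‖ < 1 := by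
      simp [hz i hi, hz j hj, abs_of_nonneg h0, h1]
    have := Complex.hasSum_re (Complex.hasSum_taylorSeries_neg_log hn)
    rwa [Complex.neg_re, Complex.log_re] at this
  have hS := hasSum_sum fun i hi => hasSum_sum fun j hj => hs i hi j hj
  have hterm : ∀ k : ℕ, ∑ i ∈ G, ∑ j ∈ G, ((ρ * (z i * (starRingEnd ℂ) (z j))) ^ k / k).re
      = ρ ^ k / k * ‖∑ i ∈ G, z i ^ k‖ ^ 2 := by
    intro k
    have : (((∑ i ∈ G, ∑ j ∈ G, ((ρ * (z i * (starRingEnd ℂ) (z j))) ^ k / k)) : ℂ))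
        = ((ρ ^ k / k * ‖∑ i ∈ G, z i ^ k‖ ^ 2 : ℝ) : ℂ) := by
      push_cast
      rw [← Complex.mul_conj', map_sum, Finset.sum_mul_sum, Finset.mul_sum]
      refine Finset.sum_congr rfl fun i _ => ?_
      rw [Finset.mul_sum]
      refine Finset.sum_congr rfl fun j _ => ?_
      rw [map_pow, mul_pow, mul_pow]
      ring
    simp_rw [← Complex.re_sum]
    rw [this, Complex.ofReal_re]
  -- All terms are nonnegative, so the one with `k = 1` is at most the sum. The term `k = 0`
  -- vanishes because division by zero gives zero.
  have h := le_hasSum hS 1 fun k _ => by rw [hterm]; positivity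
  rw [hterm] at h
  simpa using h

/-- The squares of the two sides differ by exactly `(1 - ρ)²`. This compares the smoothed kernel
with the singular one. -/
theorem sqrt_mul_norm_one_sub_le {ρ : ℝ} (h0 : 0 < ρ) {z : ℂ} (hz : ‖z‖ = 1) :
    Real.sqrt ρ * ‖1 - z‖ ≤ ‖1 - ρ * z‖ := by
  have e1 : ‖1 - z‖ ^ 2 = 2 - 2 * z.re := by
    rw [← Complex.normSq_eq_norm_sq, Complex.normSq_apply]
    have : z.re * z.re + z.im * z.im = 1 := by
      rw [← Complex.normSq_apply, Complex.normSq_eq_norm_sq, hz]; norm_num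
    simp only [Complex.sub_re, Complex.one_re, Complex.sub_im, Complex.one_im]
    linarith
  have e2 : ‖1 - ρ * z‖ ^ 2 = 1 + ρ ^ 2 - 2 * ρ * z.re := by
    rw [← Complex.normSq_eq_norm_sq, Complex.normSq_apply]
    have : z.re * z.re + z.im * z.im = 1 := by
      rw [← Complex.normSq_apply, Complex.normSq_eq_norm_sq, hz]; norm_num
    simp only [Complex.sub_re, Complex.one_re, Complex.sub_im, Complex.one_im, Complex.mul_re,
      Complex.mul_im, Complex.ofReal_re, Complex.ofReal_im]
    linear_combination ρ ^ 2 * this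
  refine abs_le_of_sq_le_sq' ?_ (norm_nonneg _) |>.2
  rw [mul_pow, Real.sq_sqrt h0.le, e1, e2]
  nlinarith [sq_nonneg (1 - ρ)]

variable {L : Type*} [Field L] [NumberField L]

open scoped Classical in
/-- The number of embeddings agreeing with `τ₀` at `α`. -/
theorem card_fiber (α : L) (τ₀ : L →+* ℂ) :
    (Finset.univ.filter fun τ : L →+* ℂ => τ α = τ₀ α).card
      = Module.finrank (IntermediateField.adjoin ℚ {α}) L := by
  rw [← card_extensions (K := IntermediateField.adjoin ℚ {α}) (τ₀.comp (algebraMap _ L))]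
  congr 1
  ext τ
  simp only [Finset.mem_filter, Finset.mem_univ, true_and]
  constructor
  · intro h
    let f : L →ₐ[ℚ] ℂ := τ.toRatAlgHom
    let f₀ : L →ₐ[ℚ] ℂ := τ₀.toRatAlgHom
    have : f.comp (IntermediateField.adjoin ℚ {α}).val
        = f₀.comp (IntermediateField.adjoin ℚ {α}).val :=
      IntermediateField.algHom_ext_of_eq_adjoin ℚ (s := {α}) rfl
        fun x hx => by simp only [Set.mem_singleton_iff] at hx; subst hx; exact h
    ext x
    exact DFunLike.congr_fun this x
  · intro h
    exact RingHom.congr_fun h (IntermediateField.AdjoinSimple.gen ℚ α)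

open scoped Classical in
/-- The number of conjugates is at least proportional to `n` for elements which are not roots of
unity, have height at most `H / n` and at most `b / n` of whose conjugates are off the unit
circle. -/
theorem card_fiber_le {α : L} (hα : ∀ m : ℕ, 0 < m → α ^ m ≠ 1)
    (G : Finset (L →+* ℂ)) (hG : ∀ τ ∈ G, ‖τ α‖ = 1) {n H b : ℝ} (hn : 0 < n) (hH : 0 ≤ H)
    (hb : 0 ≤ b)
    (hGc : n * (Gᶜ).card ≤ b * Module.finrank ℚ L)
    (hh : n * Height.logHeight₁ α ≤ H * Module.finrank ℚ L) (τ₀ : L →+* ℂ) :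
    n * (Finset.univ.filter fun τ : L →+* ℂ => τ α = τ₀ α).card
      ≤ (b + 2 * H) * Module.finrank ℚ L := by
  have hM : (0 : ℝ) ≤ Module.finrank ℚ L := Nat.cast_nonneg _
  by_cases hint : IsIntegral ℤ α
  -- Kronecker: an algebraic integer that is not a root of unity has a conjugate off the circle. The
  -- fibre over that conjugate lies in `Gᶜ`, and all fibres have the same size.
  · obtain ⟨τ₁, hτ₁⟩ : ∃ τ₁ : L →+* ℂ, ‖τ₁ α‖ ≠ 1 := by
      by_contra! h
      obtain ⟨m, hm, h1⟩ := NumberField.Embeddings.pow_eq_one_of_norm_eq_one L ℂ hint h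
      exact hα m hm h1
    have : (Finset.univ.filter fun τ : L →+* ℂ => τ α = τ₀ α).card ≤ (Gᶜ).card := by
      rw [card_fiber, ← card_fiber α τ₁]
      apply Finset.card_le_card
      intro τ hτ
      simp only [Finset.mem_filter, Finset.mem_univ, true_and] at hτ
      simp only [Finset.mem_compl]
      intro h
      exact hτ₁ (hτ ▸ hG τ h)
    calc n * _ ≤ n * (Gᶜ).card := by gcongr
      _ ≤ _ := hGc
      _ ≤ _ := by gcongr; linarith
  -- For `α` not integral the height relative to `ℚ(α)` is at least `log 2`, so the bound on the
  -- height relative to `L` limits `[L : ℚ(α)]`.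
  · rw [card_fiber]
    set K := IntermediateField.adjoin ℚ {α}
    have h1 := logHeight₁_algebraMap (L := L) (IntermediateField.AdjoinSimple.gen ℚ α)
    rw [IntermediateField.AdjoinSimple.algebraMap_gen] at h1
    have h2 : Real.log 2 ≤ Height.logHeight₁ (IntermediateField.AdjoinSimple.gen ℚ α) := by
      rw [logHeight₁_eq_sum_embeddings]
      have : (2 : ℝ) ≤ finHeight (IntermediateField.AdjoinSimple.gen ℚ α) := by
        apply two_le_finHeight
        intro h
        apply hint
        have := h.map (IsScalarTower.toAlgHom ℤ K L)
        exact this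
      have h3 : Real.log 2 ≤ Real.log (finHeight (IntermediateField.AdjoinSimple.gen ℚ α)) :=
        Real.log_le_log (by norm_num) this
      have h4 : 0 ≤ ∑ τ : K →+* ℂ, log⁺ ‖τ (IntermediateField.AdjoinSimple.gen ℚ α)‖ :=
        Finset.sum_nonneg fun _ _ => Real.posLog_nonneg
      linarith
    have h5 : (1 : ℝ) / 2 ≤ Real.log 2 := by linarith [Real.log_two_gt_d9]
    have hf : (0 : ℝ) ≤ Module.finrank K L := Nat.cast_nonneg _
    have h6 : (Module.finrank K L : ℝ) * (1 / 2) ≤ Height.logHeight₁ α := by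
      rw [h1]; gcongr; linarith
    nlinarith [mul_le_mul_of_nonneg_left h6 hn.le, mul_nonneg hb hM]

theorem sum_log_norm_eq {β : L} (hβ : β ≠ 0) :
    ∑ τ : L →+* ℂ, Real.log ‖τ β‖ = -Real.log (∏ᶠ v : FinitePlace L, v β) := by
  rw [← sum_infinitePlace_eq Real.log β, ← Real.log_inv,
    ← eq_inv_of_mul_eq_one_left (prod_abs_eq_one hβ), Real.log_prod]
  · simp
  · intro v _
    have : v β ≠ 0 := (map_ne_zero v).mpr hβ
    positivity

/-- A lower bound for the discriminant. -/
theorem neg_le_sum_log_norm_sub [IsGalois ℚ L] (α : L) :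
    -(2 * Module.finrank ℚ L * Height.logHeight₁ α) ≤
      ∑ τ : L →+* ℂ, ∑ τ' : L →+* ℂ, Real.log ‖τ α - τ' α‖ := by
  have hfin : ∀ g : L ≃ₐ[ℚ] L, finHeight (g α) = finHeight α := by
    intro g
    have := finHeight_ringHom (g : L →+* L) α
    exact (pow_left_inj₀ (finHeight_pos _).le (finHeight_pos _).le
      (Module.finrank_pos (R := ℚ) (M := L)).ne').mp this
  have hbij : ∀ τ : L →+* ℂ, Function.Bijective fun g : L ≃ₐ[ℚ] L => τ.comp (g : L →+* L) := by
    intro τ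
    rw [Fintype.bijective_iff_injective_and_card]
    constructor
    · intro g g' h
      ext x
      exact τ.injective (RingHom.congr_fun h x)
    · rw [← Nat.card_eq_fintype_card, IsGalois.card_aut_eq_finrank, NumberField.Embeddings.card]
  -- As `L` is Galois, every `τ'` is `τ ∘ g` for a unique `g`. For fixed `g` the product formula for
  -- `α - g α` turns the sum over `τ` into a finite part, controlled by `finprod_sub_le`.
  have h1 : ∑ τ : L →+* ℂ, ∑ τ' : L →+* ℂ, Real.log ‖τ α - τ' α‖
      = ∑ g : L ≃ₐ[ℚ] L, ∑ τ : L →+* ℂ, Real.log ‖τ (α - g α)‖ := by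
    rw [Finset.sum_comm]
    conv_lhs => rw [Finset.sum_comm]
    rw [Finset.sum_comm (s := (Finset.univ : Finset (L ≃ₐ[ℚ] L)))]
    refine Finset.sum_congr rfl fun τ _ => ?_
    rw [← (hbij τ).sum_comp]
    simp
  rw [h1]
  have hlog : Real.log (finHeight α) ≤ Height.logHeight₁ α := by
    rw [logHeight₁_eq_sum_embeddings]
    have : 0 ≤ ∑ τ : L →+* ℂ, log⁺ ‖τ α‖ := Finset.sum_nonneg fun _ _ => Real.posLog_nonneg
    linarith
  calc -(2 * Module.finrank ℚ L * Height.logHeight₁ α)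
      = ∑ _g : L ≃ₐ[ℚ] L, -(2 * Height.logHeight₁ α) := by
        rw [Finset.sum_const, Finset.card_univ, ← Nat.card_eq_fintype_card,
          IsGalois.card_aut_eq_finrank, nsmul_eq_mul]
        ring
    _ ≤ _ := by
        refine Finset.sum_le_sum fun g _ => ?_
        by_cases hg : α = g α
        · rw [← hg]
          simp [Height.zero_le_logHeight₁]
        · rw [sum_log_norm_eq (sub_ne_zero.mpr hg)]
          have h2 := finprod_sub_le hg
          have h3 : 0 < ∏ᶠ v : FinitePlace L, v (α - g α) := by
            rw [FinitePlace.prod_eq_inv_abs_norm (sub_ne_zero.mpr hg)]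
            have : Algebra.norm ℚ (α - g α) ≠ 0 :=
              Algebra.norm_ne_zero_iff.mpr (sub_ne_zero.mpr hg)
            positivity
          have h4 := Real.log_le_log h3 h2
          rw [hfin, Real.log_mul (finHeight_pos _).ne' (finHeight_pos _).ne'] at h4
          linarith

/-- With smoothing parameter `ρ = 1 - 1/n` a coincidence `z = w` costs `log n`, and any other pair
costs at most `-½ log ρ ≤ 1/n`. On the diagonal the last term is zero since `Real.log 0 = 0`. -/
theorem neg_log_kernel_le {z w : ℂ} (hz : ‖z‖ = 1) (hw : ‖w‖ = 1) {n : ℝ} (hn : 2 ≤ n) :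
    -Real.log ‖1 - (1 - 1 / n : ℝ) * (z * (starRingEnd ℂ) w)‖ ≤
      (if w = z then Real.log n else 0) + 1 / n - Real.log ‖z - w‖ := by
  have hn0 : 0 < n := by linarith
  split_ifs with h
  · subst h
    rw [Complex.mul_conj', hw]
    have : (1 : ℂ) - (1 - 1 / n : ℝ) * ((1 : ℝ) : ℂ) ^ 2 = ((n⁻¹ : ℝ) : ℂ) := by
      push_cast; ring
    rw [this, Complex.norm_real, Real.norm_eq_abs, abs_of_pos (by positivity), Real.log_inv]
    simp only [neg_neg, sub_self, norm_zero, Real.log_zero, sub_zero, le_add_iff_nonneg_right]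
    positivity
  · have hρ : 0 < 1 - 1 / n := by
      rw [sub_pos, div_lt_one hn0]; linarith
    have hzw : ‖z * (starRingEnd ℂ) w‖ = 1 := by simp [hz, hw]
    have h1 := sqrt_mul_norm_one_sub_le hρ hzw
    have h2 : ‖1 - z * (starRingEnd ℂ) w‖ = ‖z - w‖ := by
      have : 1 - z * (starRingEnd ℂ) w = (w - z) * (starRingEnd ℂ) w := by
        rw [sub_mul, Complex.mul_conj', hw]; norm_num
      rw [this, norm_mul, RCLike.norm_conj, hw, mul_one, norm_sub_rev]
    have h3 : 0 < ‖z - w‖ := norm_pos_iff.mpr (sub_ne_zero.mpr (Ne.symm h))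
    rw [h2] at h1
    have h4 := Real.log_le_log (by positivity) h1
    rw [Real.log_mul (by positivity) h3.ne', Real.log_sqrt hρ.le] at h4
    have h5 : -(2 / n) ≤ Real.log (1 - 1 / n) := by
      have h6 := Real.one_sub_inv_le_log_of_pos hρ
      refine le_trans ?_ h6
      have : (1 - 1 / n)⁻¹ = n / (n - 1) := by
        rw [one_sub_div hn0.ne', inv_div]
      rw [this, neg_le_sub_iff_le_add, div_le_iff₀ (by linarith)]
      have : (1 + 2 / n) * (n - 1) = n + 1 - 2 / n := by field_simp; ring
      rw [this]
      have : 2 / n ≤ 1 := by rw [div_le_one hn0]; exact hn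
      linarith
    have : 2 / n = 2 * (1 / n) := by ring
    linarith

/-- A quantitative form of Bilu's equidistribution theorem, for the first Fourier coefficient. -/
theorem sq_norm_sum_embeddings_le [IsGalois ℚ L] {α : L} (hα : ∀ m : ℕ, 0 < m → α ^ m ≠ 1)
    (G : Finset (L →+* ℂ)) (hG : ∀ τ ∈ G, ‖τ α‖ = 1) {n H b : ℝ} (hn : 2 ≤ n) (hH : 0 ≤ H)
    (hb : 0 ≤ b) (hGc : n * (Fintype.card (L →+* ℂ) - G.card) ≤ b * Module.finrank ℚ L)
    (hh : n * Height.logHeight₁ α ≤ H * Module.finrank ℚ L) :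
    ‖∑ τ ∈ G, τ α‖ ^ 2 ≤
      (10 * b + 20 * H + 8) * (Real.log n / n) * (Module.finrank ℚ L : ℝ) ^ 2 := by
  classical
  have hn0 : 0 < n := by linarith
  set M : ℝ := (Module.finrank ℚ L : ℝ) with hM
  have hM0 : 0 ≤ M := Nat.cast_nonneg _
  have hcard : (Fintype.card (L →+* ℂ) : ℝ) = M := by rw [NumberField.Embeddings.card]
  have hcompl : ((Gᶜ).card : ℝ) = Fintype.card (L →+* ℂ) - G.card := by
    rw [Finset.card_compl, Nat.cast_sub (Finset.card_le_univ G)]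
  rw [← hcompl] at hGc
  have hρ0 : 0 ≤ 1 - 1 / n := by
    rw [sub_nonneg, div_le_one hn0]; linarith
  have hρ1 : 1 - 1 / n < 1 := by
    have : 0 < 1 / n := by positivity
    linarith
  have h1 := sq_norm_sum_le_energy G (fun τ => τ α) hG hρ0 hρ1
  -- The discriminant involves all pairs, the energy only those in `G × G`. For the other pairs `log
  -- |τ α - τ' α| ≤ log 2 + log⁺ + log⁺`, and the indicators of `Gᶜ` pay for `log 2 < 1`.
  have hterm : ∀ τ τ' : L →+* ℂ,
      (if τ ∈ G then if τ' ∈ G then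
        -Real.log ‖1 - (1 - 1 / n : ℝ) * (τ α * (starRingEnd ℂ) (τ' α))‖ else 0 else 0) ≤
      (if τ' α = τ α then Real.log n else 0) + 1 / n - Real.log ‖τ α - τ' α‖
        + (if τ ∈ Gᶜ then 1 else 0) + (if τ' ∈ Gᶜ then 1 else 0) + log⁺ ‖τ α‖ + log⁺ ‖τ' α‖ := by
    intro τ τ'
    have p1 := Real.posLog_nonneg (x := ‖τ α‖)
    have p2 := Real.posLog_nonneg (x := ‖τ' α‖)
    by_cases hτ : τ ∈ G ∧ τ' ∈ G
    · have := neg_log_kernel_le (hG τ hτ.1) (hG τ' hτ.2) hn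
      simp only [hτ.1, hτ.2, if_true, Finset.mem_compl, not_true, if_false]
      linarith
    · have e0 : (if τ ∈ G then if τ' ∈ G then
        -Real.log ‖1 - (1 - 1 / n : ℝ) * (τ α * (starRingEnd ℂ) (τ' α))‖ else 0 else 0) = 0 := by
        split_ifs <;> simp_all
      rw [e0]
      have e1 : (1 : ℝ) ≤ (if τ ∈ Gᶜ then 1 else 0) + (if τ' ∈ Gᶜ then 1 else 0) := by
        simp only [Finset.mem_compl]
        by_cases a : τ ∈ G <;> by_cases c : τ' ∈ G <;> simp_all
      have e2 : Real.log ‖τ α - τ' α‖ ≤ 1 + log⁺ ‖τ α‖ + log⁺ ‖τ' α‖ := by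
        have a1 : Real.log ‖τ α - τ' α‖ ≤ log⁺ ‖τ α + -τ' α‖ := by
          rw [← sub_eq_add_neg]; rw [Real.posLog_apply]; exact le_max_right _ _
        have a2 := Real.posLog_norm_add_le (τ α) (-τ' α)
        rw [norm_neg] at a2
        linarith [Real.log_two_lt_d9]
      have e3 : 0 ≤ (if τ' α = τ α then Real.log n else 0) + 1 / n := by
        have : 0 ≤ Real.log n := Real.log_nonneg (by linarith)
        split_ifs <;> positivity
      linarith
  have hsum := Finset.sum_le_sum fun τ (_ : τ ∈ Finset.univ) =>
    Finset.sum_le_sum fun τ' (_ : τ' ∈ Finset.univ) => hterm τ τ'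
  have hl : ∑ τ : L →+* ℂ, ∑ τ' : L →+* ℂ, (if τ ∈ G then if τ' ∈ G then
        -Real.log ‖1 - (1 - 1 / n : ℝ) * (τ α * (starRingEnd ℂ) (τ' α))‖ else 0 else 0)
      = ∑ τ ∈ G, ∑ τ' ∈ G,
        -Real.log ‖1 - (1 - 1 / n : ℝ) * (τ α * (starRingEnd ℂ) (τ' α))‖ := by
    rw [← Finset.sum_subset (Finset.subset_univ G)]
    · refine Finset.sum_congr rfl fun τ hτ => ?_
      simp only [hτ, if_true]
      rw [← Finset.sum_filter, Finset.filter_mem_eq_inter, Finset.univ_inter]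
    · intro τ _ hτ
      simp [hτ]
  rw [hl] at hsum
  simp only [Finset.sum_add_distrib, Finset.sum_sub_distrib, Finset.sum_const, Finset.card_univ,
    nsmul_eq_mul, hcard, ← Finset.mul_sum] at hsum
  -- Coincident conjugates are the only source of the factor `log n`; `card_fiber_le` limits their
  -- number.
  have k1 : ∑ τ : L →+* ℂ, ∑ τ' : L →+* ℂ, (if τ' α = τ α then Real.log n else 0)
      ≤ M * ((b + 2 * H) * M / n * Real.log n) := by
    rw [← hcard, ← nsmul_eq_mul, ← Finset.card_univ, ← Finset.sum_const]
    refine Finset.sum_le_sum fun τ _ => ?_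
    rw [← Finset.sum_filter, Finset.sum_const, nsmul_eq_mul]
    have : 0 ≤ Real.log n := Real.log_nonneg (by linarith)
    gcongr
    rw [le_div_iff₀ hn0, mul_comm, Finset.card_univ, hcard]
    exact card_fiber_le hα G hG hn0 hH hb hGc hh τ
  have k2 : ∑ τ : L →+* ℂ, (if τ ∈ Gᶜ then (1 : ℝ) else 0) ≤ b * M / n := by
    rw [← Finset.sum_filter, Finset.sum_const, nsmul_eq_mul, mul_one, le_div_iff₀ hn0, mul_comm,
      Finset.filter_mem_eq_inter, Finset.univ_inter]
    exact hGc
  have hheight : Height.logHeight₁ α ≤ H * M / n := by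
    rw [le_div_iff₀ hn0, mul_comm]; exact hh
  have k3 : ∑ τ : L →+* ℂ, log⁺ ‖τ α‖ ≤ H * M / n := by
    refine le_trans ?_ hheight
    rw [logHeight₁_eq_sum_embeddings]
    linarith [log_finHeight_nonneg α]
  have k4 := neg_le_sum_log_norm_sub α
  rw [← hM] at k4
  have k5 : 2 * M * Height.logHeight₁ α ≤ 2 * M * (H * M / n) := by gcongr
  have k6 : M * ∑ τ : L →+* ℂ, (if τ ∈ Gᶜ then (1 : ℝ) else 0) ≤ M * (b * M / n) := by gcongr
  have k7 : M * ∑ τ : L →+* ℂ, log⁺ ‖τ α‖ ≤ M * (H * M / n) := by gcongr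
  have hlogn : 1 / 2 ≤ Real.log n := by
    have := Real.log_le_log (by norm_num) hn
    linarith [Real.log_two_gt_d9]
  have hhalf : (1 : ℝ) / 2 ≤ 1 - 1 / n := by
    have : 1 / n ≤ 1 / 2 := by gcongr
    linarith
  have k8 : 1 / 2 * ‖∑ τ ∈ G, τ α‖ ^ 2 ≤ (1 - 1 / n) * ‖∑ τ ∈ G, τ α‖ ^ 2 := by gcongr
  have k9 : 1 / 2 * ‖∑ τ ∈ G, τ α‖ ^ 2 ≤
      M ^ 2 / n * ((b + 2 * H) * Real.log n + 1 + 4 * H + 2 * b) := by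
    have e : M ^ 2 / n * ((b + 2 * H) * Real.log n + 1 + 4 * H + 2 * b)
      = M * ((b + 2 * H) * M / n * Real.log n) + M * (M * (1 / n)) + 2 * M * (H * M / n)
        + 2 * (M * (b * M / n)) + 2 * (M * (H * M / n)) := by
      field_simp
      ring
    rw [e]
    linarith
  have k10 : (b + 2 * H) * Real.log n + 1 + 4 * H + 2 * b ≤ (5 * b + 10 * H + 4) * Real.log n := by
    nlinarith
  have k11 : M ^ 2 / n * ((b + 2 * H) * Real.log n + 1 + 4 * H + 2 * b)
      ≤ M ^ 2 / n * ((5 * b + 10 * H + 4) * Real.log n) := by gcongr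
  have e : (10 * b + 20 * H + 8) * (Real.log n / n) * M ^ 2
    = 2 * (M ^ 2 / n * ((5 * b + 10 * H + 4) * Real.log n)) := by
    field_simp
    ring
  rw [e]
  linarith

/-! ### Almost orthogonal families and the tensor power trick. -/

/-- The Gram matrix inequality `(tr A)² ≤ rank A · tr A²` for the `p`-th Hadamard power of a Gram
matrix. -/
theorem sq_sum_gram_pow_le {ι m : Type*} [Fintype ι] [Fintype m] (u : ι → m → ℝ) (p : ℕ) :
    (∑ i, (∑ σ, u i σ * u i σ) ^ p) ^ 2 ≤
      (Fintype.card m).multichoose p * ∑ i, ∑ j, ((∑ σ, u i σ * u j σ) ^ p) ^ 2 := by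
  classical
  -- The multinomial theorem writes the Hadamard power as a sum of rank-one matrices `c s • P s (P
  -- s)ᵀ` with `c s ≥ 0`, indexed by monomials of degree `p`. Cauchy–Schwarz over the monomials, and
  -- dropping the terms with `s ≠ s'` from `tr A²`, finishes the proof.
  obtain ⟨S, c, P, hS, hc, key⟩ : ∃ (S : Finset (Sym m p)) (c : Sym m p → ℝ)
      (P : Sym m p → ι → ℝ), S.card = (Fintype.card m).multichoose p ∧ (∀ s, 0 ≤ c s) ∧
      ∀ i j, (∑ σ, u i σ * u j σ) ^ p = ∑ s ∈ S, c s * (P s i * P s j) := by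
    refine ⟨Finset.univ, fun s => (s.val.countPerms : ℝ), fun s i => (s.val.map (u i)).prod,
      by rw [Finset.card_univ, Sym.card_sym_eq_multichoose], fun s => by positivity,
      fun i j => ?_⟩
    rw [Finset.sum_pow, Finset.sym_univ]
    refine Finset.sum_congr rfl fun s _ => ?_
    rw [Multiset.prod_map_mul]
  have h1 : ∑ i, (∑ σ, u i σ * u i σ) ^ p = ∑ s ∈ S, c s * ∑ i, P s i * P s i := by
    simp_rw [key, Finset.mul_sum]
    exact Finset.sum_comm
  have h2 : ∑ i, ∑ j, ((∑ σ, u i σ * u j σ) ^ p) ^ 2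
      = ∑ s ∈ S, ∑ s' ∈ S, c s * c s' * (∑ i, P s i * P s' i) ^ 2 := by
    have : ∀ s s', c s * c s' * (∑ i, P s i * P s' i) ^ 2
        = ∑ i, ∑ j, (c s * (P s i * P s j)) * (c s' * (P s' i * P s' j)) := by
      intro s s'
      rw [sq, Finset.sum_mul_sum, Finset.mul_sum]
      refine Finset.sum_congr rfl fun i _ => ?_
      rw [Finset.mul_sum]
      exact Finset.sum_congr rfl fun j _ => by ring
    simp_rw [this, key, sq, Finset.sum_mul_sum]
    exact (Finset.sum_congr rfl fun i _ => Finset.sum_comm).trans <| Finset.sum_comm.trans <|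
      Finset.sum_congr rfl fun s _ => (Finset.sum_congr rfl fun i _ => Finset.sum_comm).trans
        Finset.sum_comm
  rw [h1, h2]
  calc (∑ s ∈ S, c s * ∑ i, P s i * P s i) ^ 2
      ≤ S.card * ∑ s ∈ S, (c s * ∑ i, P s i * P s i) ^ 2 := sq_sum_le_card_mul_sum_sq
    _ ≤ (Fintype.card m).multichoose p * ∑ s ∈ S, ∑ s' ∈ S, c s * c s' * (∑ i, P s i * P s' i) ^ 2 := by
      rw [hS]
      gcongr with s hs
      refine le_trans (le_of_eq ?_) (Finset.single_le_sum (f := fun s' =>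
        c s * c s' * (∑ i, P s i * P s' i) ^ 2) (fun s' _ => ?_) hs)
      · ring
      · have := hc s
        have := hc s'
        positivity

/-- With `N` vectors, the trace of the `p`-th Hadamard power is at least `N`, while a row
contributes at most `P · 16 ^ p + N δ ^ p` to the trace of the square. By `hδ` the part quadratic in
`N` is at most half of `N²` and can be absorbed. -/
theorem card_le_of_almost_orthogonal {ι m : Type*} [Fintype ι] [Fintype m] (u : ι → m → ℝ)
    {n p P : ℕ} {δ : ℝ} (hm : Fintype.card m ≤ n) (hdiag : ∀ i, 1 ≤ ∑ σ, u i σ * u i σ)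
    (hbd : ∀ i j, |∑ σ, u i σ * u j σ| ≤ 4)
    (hP : ∀ i, ∃ E : Finset ι, E.card ≤ P ∧ ∀ j ∉ E, (∑ σ, u i σ * u j σ) ^ 2 ≤ δ)
    (hδ₀ : 0 ≤ δ) (hδ : n.multichoose p * δ ^ p ≤ 1 / 2) :
    (Fintype.card ι : ℝ) ≤ 2 * n.multichoose p * P * 16 ^ p := by
  classical
  rcases isEmpty_or_nonempty ι with hι | ⟨⟨i₀⟩⟩
  · simp only [Fintype.card_eq_zero, Nat.cast_zero]
    positivity
  set N : ℝ := (Fintype.card ι : ℝ) with hN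
  have hNpos : 0 < N := by
    rw [hN]
    exact_mod_cast Fintype.card_pos_iff.mpr ⟨i₀⟩
  have hmc : (((Fintype.card m).multichoose p : ℕ) : ℝ) ≤ (n.multichoose p : ℕ) := by
    rw [Nat.multichoose_eq, Nat.multichoose_eq]
    exact_mod_cast Nat.choose_le_choose p (by omega)
  have hrow : ∀ i, ∑ j, ((∑ σ, u i σ * u j σ) ^ p) ^ 2 ≤ P * 16 ^ p + N * δ ^ p := by
    intro i
    obtain ⟨E, hE, hEδ⟩ := hP i
    rw [← Finset.sum_add_sum_compl E]
    refine add_le_add ?_ ?_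
    · calc ∑ j ∈ E, ((∑ σ, u i σ * u j σ) ^ p) ^ 2 ≤ ∑ j ∈ E, (16 : ℝ) ^ p := by
            refine Finset.sum_le_sum fun j _ => ?_
            rw [← pow_mul, mul_comm, pow_mul, ← sq_abs]
            have := hbd i j
            gcongr
            nlinarith [abs_nonneg (∑ σ, u i σ * u j σ)]
        _ = E.card * 16 ^ p := by simp
        _ ≤ P * 16 ^ p := by gcongr
    · calc ∑ j ∈ Eᶜ, ((∑ σ, u i σ * u j σ) ^ p) ^ 2 ≤ ∑ j ∈ Eᶜ, δ ^ p := by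
            refine Finset.sum_le_sum fun j hj => ?_
            rw [← pow_mul, mul_comm, pow_mul]
            exact pow_le_pow_left₀ (sq_nonneg _) (hEδ j (by simpa using hj)) p
        _ = Eᶜ.card * δ ^ p := by simp
        _ ≤ N * δ ^ p := by
            gcongr
            rw [hN]
            exact_mod_cast Finset.card_le_univ _
  have h0 : N ≤ ∑ i, (∑ σ, u i σ * u i σ) ^ p := by
    calc N = ∑ _i : ι, (1 : ℝ) := by simp [hN]
      _ ≤ _ := Finset.sum_le_sum fun i _ => one_le_pow₀ (hdiag i)
  have h1 : N ^ 2 ≤ n.multichoose p * (N * (P * 16 ^ p + N * δ ^ p)) := by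
    calc N ^ 2 ≤ (∑ i, (∑ σ, u i σ * u i σ) ^ p) ^ 2 := by gcongr
      _ ≤ (Fintype.card m).multichoose p * ∑ i, ∑ j, ((∑ σ, u i σ * u j σ) ^ p) ^ 2 :=
        sq_sum_gram_pow_le u p
      _ ≤ n.multichoose p * ∑ i, ∑ j, ((∑ σ, u i σ * u j σ) ^ p) ^ 2 := by gcongr
      _ ≤ n.multichoose p * ∑ _i : ι, (P * 16 ^ p + N * δ ^ p) := by
        gcongr with i
        exact hrow i
      _ = _ := by rw [Finset.sum_const, Finset.card_univ, nsmul_eq_mul]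
  nlinarith

/-- Choose `p ≈ A log n`. For `p ≤ n` the symmetric power has dimension at most `(2n) ^ p / p!`, and
`p ^ p / p! ≤ e ^ p`, so the product to be bounded is at most `(2 e C₁ log n / p) ^ p`. The choice
`A > 4 e C₁` makes the base at most 1/2, while `(32 n) ^ p` stays `exp(O((log n)²))`. -/
theorem exists_power_of_log (C₁ : ℝ) (hC₁ : 0 < C₁) :
    ∃ (n₀ : ℕ) (C : ℝ), 0 < C ∧ ∀ n : ℕ, n₀ ≤ n → ∃ p : ℕ,
      n.multichoose p * (C₁ * Real.log n / n) ^ p ≤ 1 / 2 ∧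
      2 * (n.multichoose p : ℝ) * 16 ^ p ≤ Real.exp (C * Real.log n ^ 2) := by
  set A : ℝ := 4 * Real.exp 1 * C₁ + 1 with hA
  have hApos : 0 < A := by positivity
  have hev : ∀ᶠ n : ℕ in Filter.atTop, 1 ≤ Real.log n ∧ A * Real.log n + 1 ≤ n := by
    have h1 : Filter.Tendsto (fun n : ℕ => Real.log n) Filter.atTop Filter.atTop :=
      Real.tendsto_log_atTop.comp tendsto_natCast_atTop_atTop
    have h2 := (Real.isLittleO_log_id_atTop.comp_tendsto
      (tendsto_natCast_atTop_atTop (R := ℝ))).bound (c := 1 / (2 * A)) (by positivity)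
    filter_upwards [h1.eventually_ge_atTop 1, h2, Filter.eventually_ge_atTop 2] with n hn1 hn2 hn3
    refine ⟨hn1, ?_⟩
    have hn3' : (2 : ℝ) ≤ n := by exact_mod_cast hn3
    simp only [Function.comp, id, Real.norm_eq_abs, abs_of_pos (by linarith : (0 : ℝ) < n),
      abs_of_pos (by linarith : 0 < Real.log n)] at hn2
    have : A * Real.log n ≤ n / 2 := by
      calc A * Real.log n ≤ A * (1 / (2 * A) * n) := by gcongr
        _ = n / 2 := by field_simp
    linarith
  obtain ⟨n₀, hn₀⟩ := Filter.eventually_atTop.mp hev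
  refine ⟨n₀, 5 * (A + 1) + 1, by positivity, fun n hn => ?_⟩
  obtain ⟨hlog, hAn⟩ := hn₀ n hn
  set ℓ := Real.log n with hℓ
  have hnpos : (0 : ℝ) < n := by nlinarith
  refine ⟨⌈A * ℓ⌉₊, ?_⟩
  set p := ⌈A * ℓ⌉₊ with hp
  have hp1 : A * ℓ ≤ p := Nat.le_ceil _
  have hp2 : (p : ℝ) < A * ℓ + 1 := Nat.ceil_lt_add_one (by positivity)
  have hppos : (0 : ℝ) < p := by nlinarith
  have hpn : (p : ℝ) ≤ n := by linarith
  have hmc : (n.multichoose p : ℝ) ≤ (2 * n) ^ p / p.factorial := by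
    rw [Nat.multichoose_eq]
    refine (Nat.choose_le_pow_div (α := ℝ) p (n + p - 1)).trans ?_
    gcongr
    have : ((n + p - 1 : ℕ) : ℝ) ≤ (n + p : ℕ) := by exact_mod_cast Nat.sub_le _ _
    push_cast at this
    linarith
  have hfac : (p : ℝ) ^ p / p.factorial ≤ Real.exp 1 ^ p := by
    rw [← Real.exp_nat_mul, mul_one]
    exact Real.pow_div_factorial_le_exp _ hppos.le _
  constructor
  · calc (n.multichoose p : ℝ) * (C₁ * ℓ / n) ^ p
        ≤ (2 * n) ^ p / p.factorial * (C₁ * ℓ / n) ^ p := by gcongr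
      _ = (p ^ p / p.factorial) * (2 * C₁ * ℓ / p) ^ p := by
          simp only [div_pow, mul_pow]
          field_simp
      _ ≤ Real.exp 1 ^ p * (2 * C₁ * ℓ / p) ^ p := by gcongr
      _ = (2 * Real.exp 1 * C₁ * ℓ / p) ^ p := by rw [← mul_pow]; ring
      _ ≤ (1 / 2) ^ p := by
          refine pow_le_pow_left₀ (by positivity) ?_ p
          rw [div_le_iff₀ hppos]
          nlinarith
      _ ≤ (1 / 2) ^ 1 := by
          apply pow_le_pow_of_le_one (by norm_num) (by norm_num)
          exact_mod_cast hppos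
      _ = 1 / 2 := pow_one _
  · have h2 : (n.multichoose p : ℝ) ≤ (2 * n) ^ p :=
      hmc.trans (div_le_self (by positivity) (by exact_mod_cast Nat.one_le_iff_ne_zero.mpr (Nat.factorial_ne_zero p)))
    have hn' : (n : ℝ) = Real.exp ℓ := (Real.exp_log hnpos).symm
    have h32 : (32 : ℝ) ≤ Real.exp 4 := by
      have := Real.exp_one_gt_d9
      have h4 : Real.exp 4 = Real.exp 1 ^ 4 := by rw [← Real.exp_nat_mul]; norm_num
      rw [h4]
      calc (32 : ℝ) ≤ 2.7 ^ 4 := by norm_num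
        _ ≤ _ := by gcongr; linarith
    have h2e : (2 : ℝ) ≤ Real.exp 1 := by linarith [Real.add_one_le_exp (1 : ℝ)]
    calc 2 * (n.multichoose p : ℝ) * 16 ^ p ≤ 2 * (2 * n) ^ p * 16 ^ p := by gcongr
      _ = 2 * (32 * n) ^ p := by rw [mul_assoc, ← mul_pow]; ring
      _ ≤ Real.exp 1 * (Real.exp 4 * Real.exp ℓ) ^ p := by rw [hn']; gcongr
      _ = Real.exp (1 + p * (4 + ℓ)) := by
          rw [← Real.exp_add, ← Real.exp_nat_mul, ← Real.exp_add]
      _ ≤ Real.exp ((5 * (A + 1) + 1) * ℓ ^ 2) := by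
          gcongr
          have : (p : ℝ) * (4 + ℓ) ≤ (A + 1) * ℓ * (5 * ℓ) := by
            apply mul_le_mul <;> nlinarith
          nlinarith

/-! ### Roots of unity of bounded degree. -/

section RootsOfUnity

/-- The sharper bound for odd `m` is carried through the induction so that the factor 2, lost only
at the prime 2, does not accumulate over coprime products. -/
theorem le_totient_sq (m : ℕ) (hm : 0 < m) :
    m ≤ 2 * m.totient ^ 2 ∧ (Odd m → m ≤ m.totient ^ 2) := by
  induction m using Nat.recOnPosPrimePosCoprime with
  | zero => omega
  | one => simp
  | prime_pow p a hp ha =>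
    obtain ⟨a, rfl⟩ : ∃ a', a = a' + 1 := ⟨a - 1, by omega⟩
    rw [Nat.totient_prime_pow_succ hp]
    have hpa : 1 ≤ p ^ a := Nat.one_le_pow _ _ hp.pos
    obtain rfl | hp3 : p = 2 ∨ 3 ≤ p := by have := hp.two_le; omega
    · refine ⟨?_, fun h => ?_⟩
      · rw [pow_succ]; nlinarith
      · exact absurd h (by simp [Nat.even_pow])
    · have key : p ^ (a + 1) ≤ (p ^ a * (p - 1)) ^ 2 := by
        obtain ⟨q, rfl⟩ : ∃ q, p = q + 1 := ⟨p - 1, by omega⟩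
        rw [Nat.add_sub_cancel, mul_pow, pow_succ]
        have h1 : (q + 1) ≤ q ^ 2 := by nlinarith
        have h2 : (q + 1) ^ a ≤ ((q + 1) ^ a) ^ 2 := Nat.le_self_pow (by norm_num) _
        exact Nat.mul_le_mul h2 h1
      exact ⟨by omega, fun _ => key⟩
  | coprime a b ha hb hab iha ihb =>
    obtain ⟨a1, a2⟩ := iha (by omega)
    obtain ⟨b1, b2⟩ := ihb (by omega)
    rw [Nat.totient_mul hab, mul_pow]
    refine ⟨?_, fun h => ?_⟩
    · have : Odd a ∨ Odd b := by
        by_contra! h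
        rw [Nat.not_odd_iff_even, Nat.not_odd_iff_even] at h
        have := Nat.dvd_gcd h.1.two_dvd h.2.two_dvd
        rw [hab] at this
        omega
      rcases this with h | h
      · calc a * b ≤ a.totient ^ 2 * (2 * b.totient ^ 2) := Nat.mul_le_mul (a2 h) b1
          _ = _ := by ring
      · calc a * b ≤ (2 * a.totient ^ 2) * b.totient ^ 2 := Nat.mul_le_mul a1 (b2 h)
          _ = _ := by ring
    · rw [Nat.odd_mul] at h
      exact Nat.mul_le_mul (a2 h.1) (b2 h.2)

/-- The roots of unity of order at most `X`. -/
def smallRootsOfUnity (K : Type*) [Field K] (X : ℕ) : Finset K :=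
  open scoped Classical in
  (Finset.Icc 1 X).biUnion fun m => Polynomial.nthRootsFinset m (1 : K)

theorem card_smallRootsOfUnity_le (K : Type*) [Field K] (X : ℕ) :
    (smallRootsOfUnity K X).card ≤ X ^ 2 := by
  classical
  calc (smallRootsOfUnity K X).card
      ≤ ∑ m ∈ Finset.Icc 1 X, (Polynomial.nthRootsFinset m (1 : K)).card := by
        rw [smallRootsOfUnity]
        convert Finset.card_biUnion_le
    _ ≤ ∑ m ∈ Finset.Icc 1 X, X := by
        refine Finset.sum_le_sum fun m hm => ?_
        refine le_trans ?_ (Finset.mem_Icc.mp hm).2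
        rw [Polynomial.nthRootsFinset]
        exact (Multiset.toFinset_card_le _).trans (Polynomial.card_nthRoots m 1)
    _ = X ^ 2 := by simp [sq]

theorem mem_smallRootsOfUnity {K : Type*} [Field K] [CharZero K] {ζ : K} {m : ℕ} (hm : 0 < m)
    (h : ζ ^ m = 1) {D : ℕ} (hD : (minpoly ℚ ζ).natDegree ≤ D) :
    ζ ∈ smallRootsOfUnity K (2 * D ^ 2) := by
  have hfin : IsOfFinOrder ζ := isOfFinOrder_iff_pow_eq_one.mpr ⟨m, hm, h⟩
  have hpos := hfin.orderOf_pos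
  have hprim := IsPrimitiveRoot.orderOf ζ
  have hdeg : (orderOf ζ).totient ≤ D := by
    rwa [← Polynomial.natDegree_cyclotomic (orderOf ζ) ℚ,
      Polynomial.cyclotomic_eq_minpoly_rat hprim hpos]
  simp only [smallRootsOfUnity, Finset.mem_biUnion, Finset.mem_Icc]
  refine ⟨orderOf ζ, ⟨hpos, (le_totient_sq _ hpos).1.trans (by gcongr)⟩, ?_⟩
  rw [Polynomial.mem_nthRootsFinset hpos]
  exact pow_orderOf_eq_one ζ

end RootsOfUnity

/-! ### Degrees of elements with `x + x⁻¹` in the base field. -/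

section Degree

variable {l L : Type*} [Field l] [NumberField l] [Field L] [Algebra l L] [Algebra.IsAlgebraic l L]

theorem finrank_adjoin_le_two {x : L} (hx0 : x ≠ 0) {t : l} (hx : algebraMap l L t = x + x⁻¹) :
    Module.finrank l (IntermediateField.adjoin l {x}) ≤ 2 := by
  have hint : IsIntegral l x := Algebra.IsIntegral.isIntegral x
  rw [IntermediateField.adjoin.finrank hint]
  open Polynomial in
  have hp : (X ^ 2 - C t * X + 1 : l[X]).natDegree = 2 := by compute_degree!
  open Polynomial in
  have hp0 : (X ^ 2 - C t * X + 1 : l[X]) ≠ 0 := by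
    intro h; rw [h] at hp; simp at hp
  rw [← hp]
  apply Polynomial.natDegree_le_of_dvd _ hp0
  apply minpoly.dvd
  simp only [map_add, map_sub, map_mul, map_pow, Polynomial.aeval_X, Polynomial.aeval_C, hx,
    map_one]
  field_simp
  ring

/-- Each of `x` and `y` has degree at most 2 over `l`, so their compositum has degree at most 4.
This bounds the degree of any root of unity of the form `xy` or `x/y`. -/
theorem natDegree_minpoly_le [CharZero L] {x y α : L} (hx0 : x ≠ 0) (hy0 : y ≠ 0) {t s : l}
    (hx : algebraMap l L t = x + x⁻¹) (hy : algebraMap l L s = y + y⁻¹)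
    (hα : α ∈ IntermediateField.adjoin l {x} ⊔ IntermediateField.adjoin l {y}) :
    (minpoly ℚ α).natDegree ≤ 4 * Module.finrank ℚ l := by
  set E := IntermediateField.adjoin l {x} ⊔ IntermediateField.adjoin l {y} with hE
  have h1 : Module.finrank l E ≤ 2 * 2 :=
    (IntermediateField.finrank_sup_le _ _).trans
      (Nat.mul_le_mul (finrank_adjoin_le_two hx0 hx) (finrank_adjoin_le_two hy0 hy))
  have hfin : ∀ z : L, FiniteDimensional l (IntermediateField.adjoin l {z}) := fun z =>
    IntermediateField.adjoin.finiteDimensional (Algebra.IsIntegral.isIntegral z)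
  have := hfin x
  have := hfin y
  have : FiniteDimensional l E := IntermediateField.finiteDimensional_sup _ _
  have : Module.Finite ℚ E := Module.Finite.trans l E
  have h2 : minpoly ℚ α = minpoly ℚ (⟨α, hα⟩ : E) :=
    minpoly.algebraMap_eq (algebraMap E L).injective (⟨α, hα⟩ : E)
  rw [h2]
  refine (minpoly.natDegree_le _).trans ?_
  rw [← Module.finrank_mul_finrank ℚ l E, mul_comm]
  gcongr

end Degree

/-! ### Almost orthogonality of the vectors of conjugates of `t`. -/

section GoodEmbeddings

variable {l L : Type*} [Field l] [NumberField l] [Field L] [NumberField L] [Algebra l L]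

open scoped Classical in
theorem card_good (B : Finset (l →+* ℂ)) :
    ((Finset.univ.filter fun τ : L →+* ℂ => τ.comp (algebraMap l L) ∉ B).card : ℝ)
      = Module.finrank ℚ L - B.card * Module.finrank l L := by
  have h := sum_comp_algebraMap (L := L) fun σ : l →+* ℂ => if σ ∉ B then (1 : ℝ) else 0
  rw [Finset.sum_boole] at h
  rw [h, ← Module.finrank_mul_finrank ℚ l L, Finset.sum_boole]
  have : (Finset.univ.filter fun σ : l →+* ℂ => σ ∉ B) = Bᶜ := by ext; simp
  rw [this, Finset.card_compl, Nat.cast_sub (Finset.card_le_univ B), NumberField.Embeddings.card]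
  push_cast
  ring

end GoodEmbeddings

/-- This is `4 cos θ cos φ = 2 cos (θ + φ) + 2 cos (θ - φ)`: inner products become sums of
conjugates of `xy` and `x/y`, to which equidistribution applies. -/
theorem sum_re_mul_re {L : Type*} [Field L] (G : Finset (L →+* ℂ)) {x y t s : L}
    (hx : ∀ τ ∈ G, ‖τ x‖ = 1) (hy : ∀ τ ∈ G, ‖τ y‖ = 1) (ht : t = x + x⁻¹) (hs : s = y + y⁻¹) :
    ∑ τ ∈ G, (τ t).re * (τ s).re
      = 2 * (∑ τ ∈ G, τ (x * y)).re + 2 * (∑ τ ∈ G, τ (x * y⁻¹)).re := by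
  rw [Complex.re_sum, Complex.re_sum, Finset.mul_sum, Finset.mul_sum, ← Finset.sum_add_distrib]
  refine Finset.sum_congr rfl fun τ hτ => ?_
  have h1 : ∀ z : ℂ, ‖z‖ = 1 → z⁻¹ = (starRingEnd ℂ) z := fun z hz => by
    rw [Complex.inv_def, Complex.normSq_eq_norm_sq, hz]; simp
  simp only [ht, hs, map_add, map_mul, map_inv₀, h1 _ (hx τ hτ), h1 _ (hy τ hτ), Complex.add_re,
    Complex.conj_re, Complex.mul_re, Complex.conj_im]
  ring

theorem abs_re_le_of_sq_le {z : ℂ} {c M : ℝ} (hc : 0 ≤ c) (hM : 0 ≤ M)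
    (h : ‖z‖ ^ 2 ≤ c * M ^ 2) : |z.re| ≤ Real.sqrt c * M := by
  refine (Complex.abs_re_le_norm z).trans (abs_le_of_sq_le_sq' ?_ (by positivity)).2
  rwa [mul_pow, Real.sq_sqrt hc]

section Bounds

variable {l L : Type*} [Field l] [NumberField l] [Field L] [NumberField L] [Algebra l L]

open scoped Classical in
/-- Almost orthogonality of elements of `l` which are of the form `x + x⁻¹` with `x` of small
height. -/
theorem gram_estimates [IsGalois ℚ L] (B : Finset (l →+* ℂ)) (hB : B.card ≤ 4) {R : ℝ} (hR : 0 ≤ R) {x y : L}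
    {t s : l} (hx0 : x ≠ 0) (hy0 : y ≠ 0)
    (ht : algebraMap l L t = x + x⁻¹) (hs : algebraMap l L s = y + y⁻¹)
    (hx : ∀ τ : L →+* ℂ, τ.comp (algebraMap l L) ∉ B → ‖τ x‖ = 1)
    (hy : ∀ τ : L →+* ℂ, τ.comp (algebraMap l L) ∉ B → ‖τ y‖ = 1)
    (hhx : Module.finrank ℚ l * Height.logHeight₁ x ≤ R * Module.finrank ℚ L)
    (hhy : Module.finrank ℚ l * Height.logHeight₁ y ≤ R * Module.finrank ℚ L)
    (hn : 2 ≤ Module.finrank ℚ l) :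
    |∑ σ ∈ Bᶜ, (σ t).re * (σ s).re| ≤ 4 * Module.finrank ℚ l ∧
    ((∀ m : ℕ, 0 < m → (x * y) ^ m ≠ 1) → (∀ m : ℕ, 0 < m → (x * y⁻¹) ^ m ≠ 1) →
      |∑ σ ∈ Bᶜ, (σ t).re * (σ s).re| ≤ 4 * Real.sqrt ((48 + 40 * R) *
        (Real.log (Module.finrank ℚ l) / Module.finrank ℚ l)) * Module.finrank ℚ l) ∧
    ((∀ m : ℕ, 0 < m → (x * y) ^ m ≠ 1) → x = y →
      (2 - 8 / Module.finrank ℚ l - 2 * Real.sqrt ((48 + 40 * R) *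
        (Real.log (Module.finrank ℚ l) / Module.finrank ℚ l))) * Module.finrank ℚ l ≤
      ∑ σ ∈ Bᶜ, (σ t).re * (σ s).re) := by
  set n := Module.finrank ℚ l with hndef
  set f := Module.finrank l L with hf
  have hM : Module.finrank ℚ L = n * f := (Module.finrank_mul_finrank ℚ l L).symm
  have hf0 : 0 < f := Module.finrank_pos
  have hfR : (0 : ℝ) < f := by exact_mod_cast hf0
  have hnR : (2 : ℝ) ≤ n := by exact_mod_cast hn
  have hn0 : (0 : ℝ) < n := by linarith
  have hMR : (Module.finrank ℚ L : ℝ) = n * f := by rw [hM]; push_cast; ring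
  set G : Finset (L →+* ℂ) := Finset.univ.filter fun τ => τ.comp (algebraMap l L) ∉ B with hG
  have hGx : ∀ τ ∈ G, ‖τ x‖ = 1 := fun τ hτ => hx τ (Finset.mem_filter.mp hτ).2
  have hGy : ∀ τ ∈ G, ‖τ y‖ = 1 := fun τ hτ => hy τ (Finset.mem_filter.mp hτ).2
  have hGcard : (G.card : ℝ) = n * f - B.card * f := by rw [card_good, hMR]
  have hBR : (B.card : ℝ) ≤ 4 := by exact_mod_cast hB
  have hGle : (G.card : ℝ) ≤ n * f := by rw [hGcard]; nlinarith [mul_nonneg (Nat.cast_nonneg (α := ℝ) B.card) hfR.le]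
  set S := ∑ σ ∈ Bᶜ, (σ t).re * (σ s).re with hS
  have hSG : f * S = 2 * (∑ τ ∈ G, τ (x * y)).re + 2 * (∑ τ ∈ G, τ (x * y⁻¹)).re := by
    rw [← sum_re_mul_re G hGx hGy ht hs]
    have h := sum_comp_algebraMap (L := L)
      fun σ : l →+* ℂ => if σ ∉ B then (σ t).re * (σ s).re else 0
    rw [← Finset.sum_filter, ← Finset.sum_filter] at h
    have : (Finset.univ.filter fun σ : l →+* ℂ => σ ∉ B) = Bᶜ := by ext; simp
    rw [this] at h
    exact h.symm
  have hnorm : ∀ z : L, (∀ τ ∈ G, ‖τ z‖ = 1) → ‖∑ τ ∈ G, τ z‖ ≤ n * f := by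
    intro z hz
    refine (norm_sum_le _ _).trans ?_
    rw [Finset.sum_congr rfl hz]
    simpa using hGle
  have hGxy : ∀ τ ∈ G, ‖τ (x * y)‖ = 1 := fun τ hτ => by
    rw [map_mul, norm_mul, hGx τ hτ, hGy τ hτ, one_mul]
  have hGxy' : ∀ τ ∈ G, ‖τ (x * y⁻¹)‖ = 1 := fun τ hτ => by
    rw [map_mul, map_inv₀, norm_mul, norm_inv, hGx τ hτ, hGy τ hτ, inv_one, one_mul]
  have hequi : ∀ z : L, (∀ τ ∈ G, ‖τ z‖ = 1) → (∀ m : ℕ, 0 < m → z ^ m ≠ 1) →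
      n * Height.logHeight₁ z ≤ 2 * R * Module.finrank ℚ L →
      |(∑ τ ∈ G, τ z).re| ≤ Real.sqrt ((48 + 40 * R) * (Real.log n / n)) * (n * f) := by
    intro z hz hz1 hzh
    have hlog : 0 ≤ Real.log n := Real.log_nonneg (by linarith)
    apply abs_re_le_of_sq_le (by positivity) (by positivity)
    -- The height of a product is at most the sum of heights, whence `2 * R`; `b = 4` bounds
    -- `B.card`. Then `10 b + 20 H + 8 = 48 + 40 R`.
    have := sq_norm_sum_embeddings_le hz1 G hz hnR (H := 2 * R) (b := 4) (by positivity)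
      (by norm_num) ?_ hzh
    · rw [hMR] at this
      convert this using 3
      ring
    · rw [NumberField.Embeddings.card, hMR, hGcard]
      have : (B.card : ℝ) * (n * f) ≤ 4 * (n * f) := by gcongr
      nlinarith
  have hhxy : n * Height.logHeight₁ (x * y) ≤ 2 * R * Module.finrank ℚ L := by
    have := mul_le_mul_of_nonneg_left (Height.logHeight₁_mul_le x y) hn0.le
    linarith
  have hhxy' : n * Height.logHeight₁ (x * y⁻¹) ≤ 2 * R * Module.finrank ℚ L := by
    have := mul_le_mul_of_nonneg_left (Height.logHeight₁_mul_le x y⁻¹) hn0.le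
    rw [Height.logHeight₁_inv] at this
    linarith
  refine ⟨?_, fun h1 h2 => ?_, fun h1 h2 => ?_⟩
  · have a1 := (Complex.abs_re_le_norm _).trans (hnorm _ hGxy)
    have a2 := (Complex.abs_re_le_norm _).trans (hnorm _ hGxy')
    rw [abs_le] at a1 a2 ⊢
    constructor <;> nlinarith
  · have a1 := hequi _ hGxy h1 hhxy
    have a2 := hequi _ hGxy' h2 hhxy'
    rw [abs_le] at a1 a2 ⊢
    constructor <;> nlinarith
  · have a1 := hequi _ hGxy h1 hhxy
    subst h2
    have a2 : (∑ τ ∈ G, τ (x * x⁻¹)).re = n * f - B.card * f := by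
      rw [mul_inv_cancel₀ hx0]
      simp [hGcard]
    rw [a2] at hSG
    rw [abs_le] at a1
    have : (2 - 8 / n - 2 * Real.sqrt ((48 + 40 * R) * (Real.log n / n))) * n
      = 2 * n - 8 - 2 * Real.sqrt ((48 + 40 * R) * (Real.log n / n)) * n := by
        field_simp
    rw [this]
    have hBf : (B.card : ℝ) * f ≤ 4 * f := by gcongr
    nlinarith

open scoped Classical in
/-- Few elements of a family are a root of unity times a given element or its inverse. -/
theorem card_exceptional_le {T : Finset l} {x : l → L} (hx0 : ∀ t ∈ T, x t ≠ 0)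
    (hx : ∀ t ∈ T, algebraMap l L t = x t + (x t)⁻¹) {t : l} (ht : t ∈ T) :
    (T.filter fun s => (∃ m : ℕ, 0 < m ∧ (x t * x s) ^ m = 1) ∨
      ∃ m : ℕ, 0 < m ∧ (x t * (x s)⁻¹) ^ m = 1).card
      ≤ 2 * (2 * (4 * Module.finrank ℚ l) ^ 2) ^ 2 := by
  set X := 2 * (4 * Module.finrank ℚ l) ^ 2
  set Z := smallRootsOfUnity L X
  have hmem : ∀ s ∈ T, ∀ (m : ℕ) (α : L), 0 < m → α ^ m = 1 →
      (α = x t * x s ∨ α = x t * (x s)⁻¹) → α ∈ Z := by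
    intro s hs m α hm hα h
    refine mem_smallRootsOfUnity hm hα (natDegree_minpoly_le (hx0 t ht) (hx0 s hs) (hx t ht)
      (hx s hs) ?_)
    have h1 : x t ∈ IntermediateField.adjoin l {x t} ⊔ IntermediateField.adjoin l {x s} :=
      (le_sup_left : IntermediateField.adjoin l {x t} ≤ _)
        (IntermediateField.mem_adjoin_simple_self l (x t))
    have h2 : x s ∈ IntermediateField.adjoin l {x t} ⊔ IntermediateField.adjoin l {x s} :=
      (le_sup_right : IntermediateField.adjoin l {x s} ≤ _)
        (IntermediateField.mem_adjoin_simple_self l (x s))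
    rcases h with rfl | rfl
    · exact mul_mem h1 h2
    · exact mul_mem h1 (inv_mem h2)
  -- The value `x s` determines `s`, and it equals `ζ / x t` or `x t / ζ` for a root of unity `ζ` in
  -- `Z`.
  calc _ ≤ (Z.image (fun ζ => ζ * (x t)⁻¹) ∪ Z.image (fun ζ => ζ⁻¹ * x t)).card := by
        apply Finset.card_le_card_of_injOn x
        · intro s hs
          simp only [Finset.coe_filter, Set.mem_ofPred_eq] at hs
          obtain ⟨hs, ⟨m, hm, h⟩ | ⟨m, hm, h⟩⟩ := hs
          · have := hmem s hs m _ hm h (Or.inl rfl)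
            simp only [Finset.coe_union, Finset.coe_image, Set.mem_union]
            refine Or.inl ⟨_, this, ?_⟩
            field_simp [hx0 t ht]
          · have := hmem s hs m _ hm h (Or.inr rfl)
            simp only [Finset.coe_union, Finset.coe_image, Set.mem_union]
            refine Or.inr ⟨_, this, ?_⟩
            have := hx0 t ht
            have := hx0 s hs
            field_simp
        · intro s hs s' hs' h
          simp only [Finset.coe_filter, Set.mem_ofPred_eq] at hs hs'
          apply (algebraMap l L).injective
          rw [hx s hs.1, hx s' hs'.1, h]
    _ ≤ (Z.image (fun ζ => ζ * (x t)⁻¹)).card + (Z.image (fun ζ => ζ⁻¹ * x t)).card :=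
        Finset.card_union_le _ _
    _ ≤ Z.card + Z.card := add_le_add Finset.card_image_le Finset.card_image_le
    _ ≤ 2 * X ^ 2 := by
        have : Z.card ≤ X ^ 2 := card_smallRootsOfUnity_le L X
        linarith

end Bounds

/-! ### Counting generators of a fixed field of large degree. -/

/-- The main estimate: an admissible field of large degree contains few elements `x + x⁻¹` which
generate it, with `x` of bounded Mahler measure. -/
theorem exists_card_le_of_large_degree (R : ℝ) (hR : 0 ≤ R) :
    ∃ (n₀ : ℕ) (C : ℝ), 0 < C ∧ ∀ (l : Type*) (L : Type*) [Field l] [NumberField l] [Field L]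
      [NumberField L] [Algebra l L] [IsGalois ℚ L], n₀ ≤ Module.finrank ℚ l →
      ∀ (B : Finset (l →+* ℂ)) (T : Finset l) (x : l → L), B.card ≤ 4 →
      (∀ t ∈ T, x t ≠ 0) → (∀ t ∈ T, algebraMap l L t = x t + (x t)⁻¹) →
      (∀ t ∈ T, ∀ τ : L →+* ℂ, τ.comp (algebraMap l L) ∉ B → ‖τ (x t)‖ = 1) →
      (∀ t ∈ T, Module.finrank ℚ l * Height.logHeight₁ (x t) ≤ R * Module.finrank ℚ L) →
      (∀ t ∈ T, ∀ m : ℕ, 0 < m → x t ^ m ≠ 1) →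
      (T.card : ℝ) ≤ Real.exp (C * Real.log (Module.finrank ℚ l) ^ 2) := by
  set C' := 48 + 40 * R with hC'
  have hC'0 : 0 < C' := by positivity
  obtain ⟨n₁, C, hC, hp⟩ := exists_power_of_log (16 * C') (by positivity)
  have hev : ∀ᶠ n : ℕ in Filter.atTop, C' * (Real.log n / n) ≤ 1 / 16 := by
    have h2 := (Real.isLittleO_log_id_atTop.comp_tendsto
      (tendsto_natCast_atTop_atTop (R := ℝ))).bound (c := 1 / (16 * C')) (by positivity)
    filter_upwards [h2, Filter.eventually_ge_atTop 1] with n hn1 hn2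
    have hn : (1 : ℝ) ≤ n := by exact_mod_cast hn2
    simp only [Function.comp, id, Real.norm_eq_abs, abs_of_pos (by linarith : (0 : ℝ) < n),
      abs_of_nonneg (Real.log_nonneg hn)] at hn1
    rw [← mul_div_assoc, div_le_iff₀ (by linarith)]
    calc C' * Real.log n ≤ C' * (1 / (16 * C') * n) := by gcongr
      _ = 1 / 16 * n := by field_simp
  obtain ⟨n₂, hn₂⟩ := Filter.eventually_atTop.mp hev
  -- For `n ≥ 32` and `C' log n / n ≤ 1/16` the squared lengths are at least `2 - 1/4 - 1/2 > 1`.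
  -- The extra 12 absorbs the number `P = 2048 n⁴` of exceptional partners.
  refine ⟨max (max n₁ n₂) 32, C + 12, by positivity, ?_⟩
  intro l L _ _ _ _ _ _ hn B T x hB hx0 hx hxG hxh hx1
  classical
  obtain ⟨p, hp1, hp2⟩ := hp _ ((le_max_left _ _).trans ((le_max_left _ _).trans hn))
  have hlogn := hn₂ _ ((le_max_right _ _).trans ((le_max_left _ _).trans hn))
  have hn32 : 32 ≤ Module.finrank ℚ l := (le_max_right _ _).trans hn
  set n := Module.finrank ℚ l with hndef
  have hnR : (32 : ℝ) ≤ n := by exact_mod_cast hn32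
  have hn0 : (0 : ℝ) < n := by linarith
  have hlog : 0 ≤ Real.log n := Real.log_nonneg (by linarith)
  set P := 2 * (2 * (4 * n) ^ 2) ^ 2 with hP
  set u : T → {σ // σ ∈ Bᶜ} → ℝ := fun t σ => (σ.1 t.1).re / Real.sqrt n with hu
  have hg : ∀ t s : T, ∑ σ, u t σ * u s σ = (∑ σ ∈ Bᶜ, (σ t.1).re * (σ s.1).re) / n := by
    intro t s
    rw [← Finset.sum_coe_sort Bᶜ, Finset.sum_div]
    refine Finset.sum_congr rfl fun σ _ => ?_
    simp only [hu]
    rw [div_mul_div_comm, Real.mul_self_sqrt hn0.le]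
  have hest := fun t s : T => gram_estimates B hB hR (hx0 t.1 t.2) (hx0 s.1 s.2) (hx t.1 t.2)
    (hx s.1 s.2) (hxG t.1 t.2) (hxG s.1 s.2) (hxh t.1 t.2) (hxh s.1 s.2) (by omega)
  have hmain := card_le_of_almost_orthogonal u (n := n) (p := p) (P := P)
    (δ := 16 * C' * Real.log n / n) ?_ ?_ ?_ ?_ (by positivity) hp1
  · rw [Fintype.card_coe] at hmain
    have hP2 : (P : ℝ) ≤ Real.exp (12 * Real.log n ^ 2) := by
      have h1 : 1 ≤ Real.log n := by
        rw [Real.le_log_iff_exp_le hn0]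
        linarith [Real.exp_one_lt_d9]
      have h2 : (P : ℝ) = 2048 * n ^ 4 := by rw [hP]; push_cast; ring
      have h3 : (n : ℝ) = Real.exp (Real.log n) := (Real.exp_log hn0).symm
      have h4 : (2048 : ℝ) ≤ Real.exp 8 := by
        have := Real.exp_one_gt_d9
        have h4 : Real.exp 8 = Real.exp 1 ^ 8 := by rw [← Real.exp_nat_mul]; norm_num
        rw [h4]
        calc (2048 : ℝ) ≤ 2.7 ^ 8 := by norm_num
          _ ≤ _ := by gcongr; linarith
      calc (P : ℝ) ≤ Real.exp 8 * Real.exp (Real.log n) ^ 4 := by rw [h2, ← h3]; gcongr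
        _ = Real.exp (8 + 4 * Real.log n) := by
          rw [← Real.exp_nat_mul, ← Real.exp_add]; norm_num
        _ ≤ _ := by gcongr; nlinarith
    calc (T.card : ℝ) ≤ 2 * n.multichoose p * P * 16 ^ p := hmain
      _ = (2 * n.multichoose p * 16 ^ p) * P := by ring
      _ ≤ Real.exp (C * Real.log n ^ 2) * Real.exp (12 * Real.log n ^ 2) := by gcongr
      _ = _ := by rw [← Real.exp_add]; ring_nf
  · rw [Fintype.card_coe]
    refine (Finset.card_le_univ _).trans ?_
    rw [NumberField.Embeddings.card]
  · intro t
    rw [hg, le_div_iff₀ hn0, one_mul]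
    have h := (hest t t).2.2 (fun m hm h => hx1 t.1 t.2 (2 * m) (by omega) (by rw [pow_mul, sq]; exact h)) rfl
    refine le_trans ?_ h
    have h1 : Real.sqrt (C' * (Real.log n / n)) ≤ 1 / 4 := by
      rw [Real.sqrt_le_left (by norm_num)]
      linarith
    have h2 : 8 / (n : ℝ) ≤ 1 / 4 := by
      rw [div_le_iff₀ hn0]; linarith
    nlinarith
  · intro t s
    rw [hg, abs_div, abs_of_pos hn0, div_le_iff₀ hn0]
    exact (hest t s).1
  · intro t
    refine ⟨(T.filter fun s => (∃ m : ℕ, 0 < m ∧ (x t * x s) ^ m = 1) ∨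
      ∃ m : ℕ, 0 < m ∧ (x t * (x s)⁻¹) ^ m = 1).subtype (· ∈ T), ?_, ?_⟩
    · rw [Finset.card_subtype]
      refine (Finset.card_filter_le _ _).trans ?_
      exact card_exceptional_le hx0 hx t.2
    · intro s hs
      simp only [Finset.mem_subtype, Finset.mem_filter, s.2, true_and, not_or, not_exists,
        not_and] at hs
      have h := (hest t s).2.1 hs.1 hs.2
      rw [hg, ← sq_abs, abs_div, abs_of_pos hn0]
      have h1 : |∑ σ ∈ Bᶜ, (σ t.1).re * (σ s.1).re| / n
          ≤ 4 * Real.sqrt (C' * (Real.log n / n)) := by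
        rw [div_le_iff₀ hn0]; exact h
      calc _ ≤ (4 * Real.sqrt (C' * (Real.log n / n))) ^ 2 := by gcongr
        _ = 16 * C' * Real.log n / n := by
          rw [mul_pow, Real.sq_sqrt (by positivity)]; ring

/-! ### The number of subfields of a number field. -/

section Subfields

variable {k : Type*} [Field k] [NumberField k]

/-- The equalizer of a family of embeddings with a given one. -/
def equalizerField (σ₀ : k →ₐ[ℚ] ℂ) (S : Set (k →ₐ[ℚ] ℂ)) : IntermediateField ℚ k where
  carrier := {x | ∀ σ ∈ S, σ x = σ₀ x}
  mul_mem' hx hy σ hσ := by rw [map_mul, map_mul, hx σ hσ, hy σ hσ]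
  add_mem' hx hy σ hσ := by rw [map_add, map_add, hx σ hσ, hy σ hσ]
  algebraMap_mem' r σ _ := by simp
  inv_mem' x hx σ hσ := by rw [map_inv₀, map_inv₀, hx σ hσ]

theorem mem_equalizerField {σ₀ : k →ₐ[ℚ] ℂ} {S : Set (k →ₐ[ℚ] ℂ)} {x : k} :
    x ∈ equalizerField σ₀ S ↔ ∀ σ ∈ S, σ x = σ₀ x := Iff.rfl

/-- Otherwise every root of the separable polynomial `minpoly l x`, taken in `ℂ` along `σ₀`, would
equal `σ₀ x`, so its degree would be 1. -/
theorem exists_embedding_ne (σ₀ : k →ₐ[ℚ] ℂ) (l : IntermediateField ℚ k) {x : k} (hx : x ∉ l) :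
    ∃ σ : k →ₐ[ℚ] ℂ, (∀ y ∈ l, σ y = σ₀ y) ∧ σ x ≠ σ₀ x := by
  by_contra! h
  apply hx
  let := (σ₀.toRingHom.comp (algebraMap l k)).toAlgebra
  have hint : IsIntegral l x := Algebra.IsIntegral.isIntegral x
  have hsub : (minpoly l x).rootSet ℂ ⊆ {σ₀ x} := by
    rw [← Algebra.IsAlgebraic.range_eval_eq_rootSet_minpoly (K := k) ℂ x]
    rintro _ ⟨ψ, rfl⟩
    refine h (ψ.restrictScalars ℚ) fun y hy => ?_
    exact ψ.commutes ⟨y, hy⟩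
  have hcard := Polynomial.card_rootSet_eq_natDegree (K := ℂ)
    (Algebra.IsSeparable.isSeparable l x) (IsAlgClosed.splits _)
  have h1 : (minpoly l x).natDegree ≤ 1 := by
    rw [← hcard, ← Nat.card_eq_fintype_card]
    refine (Nat.card_mono (Set.finite_singleton _) hsub).trans ?_
    simp
  have h2 : (minpoly l x).natDegree = 1 := le_antisymm h1 (minpoly.natDegree_pos hint)
  obtain ⟨y, hy⟩ := minpoly.natDegree_eq_one_iff.mp h2
  rw [← hy]
  exact y.2

theorem two_mul_finrank_le {F F' : IntermediateField ℚ k} (h : F' < F) :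
    2 * Module.finrank ℚ F' ≤ Module.finrank ℚ F := by
  obtain ⟨c, hc⟩ := IntermediateField.finrank_dvd_of_le_right h.le
  have hpos : 0 < Module.finrank ℚ F := Module.finrank_pos
  rcases c with _ | _ | c
  · omega
  · exfalso
    exact h.ne (IntermediateField.eq_of_le_of_finrank_eq h.le (by omega))
  · rw [hc]; nlinarith

/-- As long as `F ≠ l`, some embedding agrees with `σ₀` on `l` but not on `F`. Intersecting `F` with
its equalizer at least halves the degree, so `log₂ N` embeddings suffice to cut out `l`. -/
theorem exists_equalizerField (σ₀ : k →ₐ[ℚ] ℂ) (l : IntermediateField ℚ k) :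
    ∀ (N : ℕ) (F : IntermediateField ℚ k), Module.finrank ℚ F ≤ N → l ≤ F →
      ∃ S : List (k →ₐ[ℚ] ℂ), 2 ^ S.length ≤ N ∧ l = F ⊓ equalizerField σ₀ {σ | σ ∈ S} := by
  intro N
  induction N using Nat.strong_induction_on with
  | _ N ih =>
    intro F hF hl
    have hpos : 0 < Module.finrank ℚ F := Module.finrank_pos
    rcases hl.eq_or_lt with rfl | hlt
    · refine ⟨[], by simp; omega, le_antisymm (le_inf le_rfl fun x _ => ?_) inf_le_left⟩
      simp [mem_equalizerField]
    · obtain ⟨x, hxF, hxl⟩ := Set.exists_of_ssubset hlt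
      obtain ⟨σ, hσl, hσx⟩ := exists_embedding_ne σ₀ l hxl
      set F' := F ⊓ equalizerField σ₀ {σ} with hF'
      have hF'F : F' < F := by
        refine lt_of_le_of_ne inf_le_left fun h => hσx ?_
        have : x ∈ F' := h ▸ hxF
        exact this.2 σ rfl
      have h2 := two_mul_finrank_le hF'F
      have hpos' : 0 < Module.finrank ℚ F' := Module.finrank_pos
      obtain ⟨S, hS, hSl⟩ := ih (N / 2) (by omega) F' (by omega)
        (le_inf hl fun y hy τ hτ => by rw [Set.mem_singleton_iff.mp hτ]; exact hσl y hy)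
      refine ⟨σ :: S, ?_, ?_⟩
      · rw [List.length_cons, pow_succ]; omega
      · rw [hSl, hF', inf_assoc]
        congr 1
        ext y
        simp [IntermediateField.mem_inf, mem_equalizerField]

variable (k) in
theorem card_intermediateField_le : Finite (IntermediateField ℚ k) ∧
    Nat.card (IntermediateField ℚ k) ≤
      Module.finrank ℚ k ^ Nat.log 2 (Module.finrank ℚ k) := by
  have σ₀ : k →ₐ[ℚ] ℂ := IsAlgClosed.lift
  set d := Module.finrank ℚ k with hd
  set r := Nat.log 2 d
  have hsurj : Function.Surjective fun f : Fin r → (k →ₐ[ℚ] ℂ) =>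
      equalizerField σ₀ (Set.range f) := by
    intro l
    obtain ⟨S, hS, hl⟩ := exists_equalizerField σ₀ l d ⊤
      (by rw [IntermediateField.finrank_top']) le_top
    have hlen : S.length ≤ r := Nat.le_log_of_pow_le (by norm_num) hS
    -- The list is padded with `σ₀`, which imposes no condition.
    refine ⟨fun i => S.getD i σ₀, ?_⟩
    rw [hl, top_inf_eq]
    ext x
    simp only [mem_equalizerField, Set.mem_range, forall_exists_index, forall_apply_eq_imp_iff]
    constructor
    · intro h σ hσ
      obtain ⟨i, hi, rfl⟩ := List.getElem_of_mem hσ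
      have := h ⟨i, by omega⟩
      rwa [List.getD_eq_getElem _ _ hi] at this
    · intro h i
      by_cases hi : (i : ℕ) < S.length
      · rw [List.getD_eq_getElem _ _ hi]
        exact h _ (List.getElem_mem hi)
      · rw [List.getD_eq_default _ _ (by omega)]
  refine ⟨Finite.of_surjective _ hsurj, ?_⟩
  refine (Nat.card_le_card_of_surjective _ hsurj).trans ?_
  rw [Nat.card_eq_fintype_card, Fintype.card_fun, Fintype.card_fin, AlgHom.card]

end Subfields

/-! ### Northcott's theorem and fields of bounded degree. -/

section SmallDegree

/-- A form of Northcott's theorem: the algebraic numbers of bounded degree and height form a finite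
set. -/
theorem exists_finite_of_height_le (R : ℝ) (D : ℕ) :
    ∃ Z : Set ℂ, Z.Finite ∧ ∀ (K : Type*) [Field K] [NumberField K], Module.finrank ℚ K ≤ D →
      ∀ x : K, Height.logHeight₁ x ≤ R → ∀ τ : K →+* ℂ, τ x ∈ Z := by
  set c := max (Real.exp R * Real.exp R) 1 ^ D * 2 ^ D with hc
  set U : Set ℤ := Set.Icc (-⌈c⌉) ⌈c⌉ with hU
  have hUfin : U.Finite := Set.finite_Icc _ _
  set W : Set ℂ := ⋃ (f : Polynomial ℤ) (_ : f.natDegree ≤ D ∧ ∀ i, f.coeff i ∈ U),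
    ↑((f.map (Int.castRingHom ℂ)).roots.toFinset) with hW
  have hWfin : W.Finite := Polynomial.bUnion_roots_finite (Int.castRingHom ℂ) D hUfin
  refine ⟨⋃ m ∈ Finset.Icc 1 ⌊Real.exp R⌋₊, (fun z : ℂ => z / m) '' W, ?_, ?_⟩
  · exact Set.Finite.biUnion (Finset.finite_toSet _) fun m _ => hWfin.image _
  · intro K _ _ hD x hx τ
    -- A denominator `m` bounded by the height makes `m x` integral. Its conjugates are bounded, so
    -- its minimal polynomial is one of finitely many over `ℤ`.
    obtain ⟨m, hm0, hm, hint⟩ := exists_nat_le_mulHeight₁ x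
    have hmul : Height.mulHeight₁ x ≤ Real.exp R := by
      rw [← Real.log_le_iff_le_exp (Height.mulHeight₁_pos x)]; exact hx
    have hmR : (m : ℝ) ≤ Real.exp R := hm.trans hmul
    have hnorm : ∀ φ : K →+* ℂ, ‖φ (m * x)‖ ≤ Real.exp R * Real.exp R := by
      intro φ
      rw [map_mul, norm_mul, map_natCast, Complex.norm_natCast]
      gcongr
      rcases eq_or_ne x 0 with rfl | hx0
      · simp [Real.exp_nonneg]
      rw [← Real.log_le_iff_le_exp (by simpa using hx0)]
      refine le_trans ?_ hx
      rw [logHeight₁_eq_sum_embeddings]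
      have h1 : log⁺ ‖φ x‖ ≤ ∑ τ : K →+* ℂ, log⁺ ‖τ x‖ :=
        Finset.single_le_sum (f := fun τ : K →+* ℂ => log⁺ ‖τ x‖)
          (fun _ _ => Real.posLog_nonneg) (Finset.mem_univ φ)
      have h2 : Real.log ‖φ x‖ ≤ log⁺ ‖φ x‖ := by rw [Real.posLog_apply]; exact le_max_right _ _
      linarith [log_finHeight_nonneg x]
    have hcoeff := fun i => Embeddings.coeff_bdd_of_norm_le hnorm i
    have hmin : minpoly ℚ (m * x : K) = (minpoly ℤ (m * x : K)).map (algebraMap ℤ ℚ) :=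
      minpoly.isIntegrallyClosed_eq_field_fractions' ℚ hint
    simp only [Set.mem_iUnion]
    refine ⟨m, Finset.mem_Icc.mpr ⟨Nat.one_le_iff_ne_zero.mpr hm0, Nat.le_floor hmR⟩,
      τ (m * x), ?_, ?_⟩
    · rw [hW]
      simp only [Set.mem_iUnion]
      refine ⟨minpoly ℤ (m * x : K), ⟨?_, fun i => ?_⟩, ?_⟩
      · have := minpoly.natDegree_le (A := ℚ) (m * x : K)
        rw [hmin, (minpoly.monic hint).natDegree_map] at this
        omega
      · have h1 := hcoeff i
        rw [hmin, Polynomial.coeff_map] at h1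
        have h2 : max (Real.exp R * Real.exp R) 1 ^ Module.finrank ℚ K
            * ((Module.finrank ℚ K).choose (Module.finrank ℚ K / 2) : ℕ) ≤ c := by
          rw [hc]
          have h3 : (((Module.finrank ℚ K).choose (Module.finrank ℚ K / 2) : ℕ) : ℝ) ≤ 2 ^ D := by
            calc (((Module.finrank ℚ K).choose (Module.finrank ℚ K / 2) : ℕ) : ℝ)
                ≤ ((2 ^ Module.finrank ℚ K : ℕ) : ℝ) := by
                  exact_mod_cast Nat.choose_le_two_pow _ _
              _ = 2 ^ Module.finrank ℚ K := by push_cast; rfl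
              _ ≤ 2 ^ D := by gcongr; norm_num
          gcongr
          exact le_max_right _ _
        have h4 : |((minpoly ℤ (m * x : K)).coeff i : ℝ)| ≤ c := by
          refine le_trans (le_of_eq ?_) (h1.trans h2)
          simp [Real.norm_eq_abs, ← Rat.norm_cast_real]
        rw [abs_le] at h4
        rw [hU, Set.mem_Icc]
        constructor
        · have : (-⌈c⌉ : ℝ) ≤ ((minpoly ℤ (m * x : K)).coeff i : ℝ) := by
            linarith [Int.le_ceil c]
          exact_mod_cast this
        · have := h4.2.trans (Int.le_ceil c)
          exact_mod_cast this
      · have hne : (minpoly ℤ (m * x : K)).map (Int.castRingHom ℂ) ≠ 0 :=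
          ((minpoly.monic hint).map _).ne_zero
        simp only [Finset.mem_coe, Multiset.mem_toFinset]
        rw [Polynomial.mem_roots hne, Polynomial.IsRoot, Polynomial.eval_map]
        have := Polynomial.hom_eval₂ (minpoly ℤ (m * x : K)) (algebraMap ℤ K) τ (m * x)
        rw [← Polynomial.aeval_def, minpoly.aeval, map_zero] at this
        rw [this]
        congr 1
        exact Subsingleton.elim _ _
    · have : (m : ℂ) ≠ 0 := by exact_mod_cast hm0
      simp only [map_mul, map_natCast]
      field_simp

end SmallDegree

/-- A field generated by `t` contains few elements `x + x⁻¹` generating it, with `x` of bounded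
Mahler measure and with almost all conjugates on the unit circle. -/
theorem exists_card_le (R : ℝ) (hR : 0 ≤ R) :
    ∃ C : ℝ, 0 < C ∧ ∀ (l : Type*) (L : Type*) [Field l] [NumberField l] [Field L]
      [NumberField L] [Algebra l L] [IsGalois ℚ L],
      ∀ (B : Finset (l →+* ℂ)) (T : Finset l) (x : l → L), B.card ≤ 4 →
      (∀ t ∈ T, x t ≠ 0) → (∀ t ∈ T, algebraMap l L t = x t + (x t)⁻¹) →
      (∀ t ∈ T, ∀ τ : L →+* ℂ, τ.comp (algebraMap l L) ∉ B → ‖τ (x t)‖ = 1) →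
      (∀ t ∈ T, Module.finrank ℚ l * Height.logHeight₁ (x t) ≤ R * Module.finrank ℚ L) →
      (∀ t ∈ T, ∀ m : ℕ, 0 < m → x t ^ m ≠ 1) →
      (T.card : ℝ) ≤ C * Real.exp (C * Real.log (Module.finrank ℚ l) ^ 2) := by
  obtain ⟨n₀, C, hC, hlarge⟩ := exists_card_le_of_large_degree R hR
  -- By `natDegree_minpoly_le` the field `ℚ(x)` has degree at most `4 [l : ℚ]`. The height relative
  -- to `ℚ(x)` is then at most `4 R`.
  obtain ⟨Z, hZ, hsmall⟩ := exists_finite_of_height_le (4 * R) (4 * n₀)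
  refine ⟨C + Z.ncard + 1, by positivity, ?_⟩
  intro l L _ _ _ _ _ _ B T x hB hx0 hx hxG hxh hx1
  have hexp : ∀ c : ℝ, 0 ≤ c → 1 ≤ Real.exp (c * Real.log (Module.finrank ℚ l) ^ 2) :=
    fun c hc => Real.one_le_exp (by positivity)
  rcases le_or_gt n₀ (Module.finrank ℚ l) with hn | hn
  · calc (T.card : ℝ) ≤ Real.exp (C * Real.log (Module.finrank ℚ l) ^ 2) :=
          hlarge l L hn B T x hB hx0 hx hxG hxh hx1
      _ ≤ Real.exp ((C + Z.ncard + 1) * Real.log (Module.finrank ℚ l) ^ 2) := by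
          gcongr
          have : (0 : ℝ) ≤ Z.ncard := Nat.cast_nonneg _
          linarith
      _ ≤ _ := le_mul_of_one_le_left (Real.exp_nonneg _)
          (by have : (0 : ℝ) ≤ Z.ncard := Nat.cast_nonneg _
              linarith)
  · have hle : T.card ≤ Z.ncard := by
      obtain ⟨τ⟩ : Nonempty (L →+* ℂ) := inferInstance
      rw [Set.ncard_eq_toFinset_card Z hZ]
      apply Finset.card_le_card_of_injOn fun t => τ (x t)
      · intro t ht
        simp only [Set.Finite.coe_toFinset]
        set K := IntermediateField.adjoin ℚ {x t}
        have hKdeg : Module.finrank ℚ K ≤ 4 * Module.finrank ℚ l := by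
          rw [IntermediateField.adjoin.finrank (Algebra.IsIntegral.isIntegral _)]
          apply natDegree_minpoly_le (hx0 t ht) (hx0 t ht) (hx t ht) (hx t ht)
          rw [sup_idem]
          exact IntermediateField.mem_adjoin_simple_self l (x t)
        have hh := logHeight₁_algebraMap (L := L) (IntermediateField.AdjoinSimple.gen ℚ (x t))
        rw [IntermediateField.AdjoinSimple.algebraMap_gen] at hh
        refine hsmall K (hKdeg.trans (by omega)) (IntermediateField.AdjoinSimple.gen ℚ (x t)) ?_
          (τ.comp (algebraMap K L))
        have h1 := hxh t ht
        rw [hh, ← Module.finrank_mul_finrank ℚ K L] at h1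
        have hl : (0 : ℝ) < Module.finrank ℚ l := by exact_mod_cast Module.finrank_pos
        have hf : (0 : ℝ) < Module.finrank K L := by exact_mod_cast Module.finrank_pos
        have hKR : (Module.finrank ℚ K : ℝ) ≤ 4 * Module.finrank ℚ l := by exact_mod_cast hKdeg
        push_cast at h1
        have h2 : (Module.finrank ℚ l * Module.finrank K L : ℝ) *
            Height.logHeight₁ (IntermediateField.AdjoinSimple.gen ℚ (x t)) ≤
            (Module.finrank ℚ l * Module.finrank K L : ℝ) * (4 * R) := by
          calc _ ≤ R * (Module.finrank ℚ K * Module.finrank K L) := by linarith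
            _ ≤ R * (4 * Module.finrank ℚ l * Module.finrank K L) := by gcongr
            _ = _ := by ring
        exact le_of_mul_le_mul_left h2 (by positivity)
      · intro t ht s hs h
        apply (algebraMap l L).injective
        rw [hx t ht, hx s hs, τ.injective h]
    have hleR : (T.card : ℝ) ≤ Z.ncard := by exact_mod_cast hle
    have h1 := hexp (C + Z.ncard + 1) (by positivity)
    have h2 : (0 : ℝ) ≤ Z.ncard := Nat.cast_nonneg _
    nlinarith

theorem finrank_mul_logHeight₁ {K L : Type*} [Field K] [NumberField K] [Field L] [NumberField L]
    (φ : K →+* L) (x : K) :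
    Module.finrank ℚ K * Height.logHeight₁ (φ x) = Module.finrank ℚ L * Height.logHeight₁ x := by
  let := φ.toAlgebra
  have h := logHeight₁_algebraMap (L := L) x
  rw [RingHom.algebraMap_toAlgebra] at h
  rw [h, ← Module.finrank_mul_finrank ℚ K L]
  push_cast
  ring

/-! ### From the algebraic closure of `k` to a common Galois field. -/

section Ambient

variable {k : Type*} [Field k] [NumberField k]

theorem exists_galois_subfield (S : Finset (AlgebraicClosure k)) :
    ∃ L : IntermediateField ℚ (AlgebraicClosure k), FiniteDimensional ℚ L ∧ IsGalois ℚ L ∧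
      (∀ x ∈ S, x ∈ L) ∧ ∀ t : k, algebraMap k (AlgebraicClosure k) t ∈ L := by
  have halg := isAlgebraic_algebraicClosure k
  have : IsAlgClosure ℚ (AlgebraicClosure k) := ⟨inferInstance, halg⟩
  have : Normal ℚ (AlgebraicClosure k) := IsAlgClosure.normal ℚ _
  set φ : k →ₐ[ℚ] AlgebraicClosure k := IsScalarTower.toAlgHom ℚ k (AlgebraicClosure k)
  set E := IntermediateField.adjoin ℚ (S : Set (AlgebraicClosure k)) ⊔ φ.fieldRange with hE
  have h1 : FiniteDimensional ℚ (IntermediateField.adjoin ℚ (S : Set (AlgebraicClosure k))) :=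
    IntermediateField.finiteDimensional_adjoin fun x _ => Algebra.IsIntegral.isIntegral x
  have h2 : FiniteDimensional ℚ φ.fieldRange :=
    Module.Finite.of_surjective φ.rangeRestrict.toLinearMap φ.rangeRestrict_surjective
  have h3 : FiniteDimensional ℚ E := IntermediateField.finiteDimensional_sup _ _
  refine ⟨IntermediateField.normalClosure ℚ E (AlgebraicClosure k), inferInstance, ?_, ?_, ?_⟩
  · have hn : Normal ℚ (IntermediateField.normalClosure ℚ E (AlgebraicClosure k)) :=
      normalClosure.normal ℚ E _
    exact ⟨⟩
  · intro x hx
    exact E.le_normalClosure ((le_sup_left : _ ≤ E) (IntermediateField.subset_adjoin ℚ _ hx))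
  · intro t
    exact E.le_normalClosure ((le_sup_right : _ ≤ E) ⟨t, rfl⟩)

/-- The elements `x` of the algebraic closure with `x + x⁻¹ = t`, of bounded Mahler measure, and all
of whose conjugates over good embeddings of `k` lie on the unit circle. -/
structure IsGoodRoot (R : ℝ) (B : Finset (k →+* ℂ)) (t : k) (x : AlgebraicClosure k) : Prop where
  ne_zero : x ≠ 0
  add_inv : algebraMap k (AlgebraicClosure k) t = x + x⁻¹
  logMahler_le : logMahler x ≤ R
  norm_eq_one : ∀ τ : AlgebraicClosure k →+* ℂ,
    τ.comp (algebraMap k (AlgebraicClosure k)) ∉ B → ‖τ x‖ = 1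

theorem exists_extension (L : IntermediateField ℚ (AlgebraicClosure k)) (τ : L →+* ℂ) :
    ∃ τ' : AlgebraicClosure k →+* ℂ, ∀ y : L, τ' y = τ y := by
  have halg := isAlgebraic_algebraicClosure k
  have : Algebra.IsAlgebraic L (AlgebraicClosure k) := Algebra.IsAlgebraic.tower_top (K := ℚ) L
  let := τ.toAlgebra
  let f : AlgebraicClosure k →ₐ[L] ℂ := IsAlgClosed.lift
  exact ⟨f, fun y => f.commutes y⟩

theorem finrank_adjoin_le {t : k} {x : AlgebraicClosure k}
    (h : algebraMap k (AlgebraicClosure k) t = x + x⁻¹) :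
    Module.finrank ℚ (IntermediateField.adjoin ℚ {t})
      ≤ Module.finrank ℚ (IntermediateField.adjoin ℚ {x}) := by
  have halg := isAlgebraic_algebraicClosure k
  have := numberField_adjoin x
  rw [IntermediateField.adjoin.finrank (Algebra.IsIntegral.isIntegral t),
    ← minpoly.algebraMap_eq (algebraMap k (AlgebraicClosure k)).injective t, h]
  have hmem : x + x⁻¹ ∈ IntermediateField.adjoin ℚ {x} :=
    add_mem (IntermediateField.mem_adjoin_simple_self ℚ x)
      (inv_mem (IntermediateField.mem_adjoin_simple_self ℚ x))
  have h2 : minpoly ℚ (x + x⁻¹) = minpoly ℚ (⟨x + x⁻¹, hmem⟩ : IntermediateField.adjoin ℚ {x}) :=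
    minpoly.algebraMap_eq (algebraMap (IntermediateField.adjoin ℚ {x}) _).injective
      (⟨x + x⁻¹, hmem⟩ : IntermediateField.adjoin ℚ {x})
  rw [h2]
  exact minpoly.natDegree_le _

/-- The Mahler measure is the height relative to `ℚ(x)`, so the absolute height is at most `R /
[ℚ(x) : ℚ] ≤ R / n`. It is applied with `n = [ℚ(t) : ℚ]`, by `finrank_adjoin_le`. -/
theorem logHeight₁_mul_le (L : IntermediateField ℚ (AlgebraicClosure k)) [NumberField L]
    {x : AlgebraicClosure k} (hx : x ∈ L) {n : ℕ}
    (hn : n ≤ Module.finrank ℚ (IntermediateField.adjoin ℚ {x})) {R : ℝ} (h : logMahler x ≤ R) :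
    n * Height.logHeight₁ (⟨x, hx⟩ : L) ≤ R * Module.finrank ℚ L := by
  have := numberField_adjoin x
  have hle : IntermediateField.adjoin ℚ {x} ≤ L := by simpa using hx
  have h1 := finrank_mul_logHeight₁ (IntermediateField.inclusion hle).toRingHom
    (IntermediateField.AdjoinSimple.gen ℚ x)
  have h2 : (IntermediateField.inclusion hle).toRingHom (IntermediateField.AdjoinSimple.gen ℚ x)
    = ⟨x, hx⟩ := rfl
  rw [h2] at h1
  have h3 : Height.logHeight₁ (IntermediateField.AdjoinSimple.gen ℚ x) ≤ R := by
    rw [← sumPosLog_eq]; exact h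
  have h5 := Height.zero_le_logHeight₁ (⟨x, hx⟩ : L)
  have hnR : (n : ℝ) ≤ Module.finrank ℚ (IntermediateField.adjoin ℚ {x}) := by exact_mod_cast hn
  calc _ ≤ (Module.finrank ℚ (IntermediateField.adjoin ℚ {x}) : ℝ) *
        Height.logHeight₁ (⟨x, hx⟩ : L) := by gcongr
    _ ≤ Module.finrank ℚ L * R := by rw [h1]; gcongr
    _ = _ := mul_comm _ _

end Ambient

/-! ### Summation over subfields. -/

/-- The bound for elements generating a given subfield. -/
theorem exists_card_le_of_adjoin_eq (R : ℝ) (hR : 0 ≤ R) :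
    ∃ C : ℝ, 0 < C ∧ ∀ (k : Type*) [Field k] [NumberField k] (B : Finset (k →+* ℂ)),
      B.card ≤ 4 → ∀ (l : IntermediateField ℚ k) (T : Finset k) (x : k → AlgebraicClosure k),
      (∀ t ∈ T, IntermediateField.adjoin ℚ {t} = l) → (∀ t ∈ T, IsGoodRoot R B t (x t)) →
      (∀ t ∈ T, ∀ m : ℕ, 0 < m → x t ^ m ≠ 1) →
      (T.card : ℝ) ≤ C * Real.exp (C * Real.log (Module.finrank ℚ l) ^ 2) := by
  obtain ⟨C, hC, h⟩ := exists_card_le R hR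
  refine ⟨C, hC, fun k _ _ B hB l T x hl hx hx1 => ?_⟩
  classical
  obtain ⟨L, hLf, hLg, hLx, hLk⟩ := exists_galois_subfield (T.image x)
  have : NumberField L := {}
  let φ : l →+* L := ((algebraMap k (AlgebraicClosure k)).comp (algebraMap l k)).codRestrict L
    fun t => hLk t
  let := φ.toAlgebra
  have hxL : ∀ t ∈ T, x t ∈ L := fun t ht => hLx _ (Finset.mem_image_of_mem _ ht)
  let x' : l → L := fun t => if ht : x t ∈ L then ⟨x t, ht⟩ else 0
  have hx' : ∀ t : l, (ht : (t : k) ∈ T) → x' t = ⟨x t, hxL t ht⟩ := fun t ht => by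
    simp only [x', dif_pos (hxL t ht)]
  have hTl : ∀ t ∈ T, t ∈ l := fun t ht => hl t ht ▸ IntermediateField.mem_adjoin_simple_self ℚ t
  have hcard : T.card = (T.subtype (· ∈ l)).card := by
    rw [Finset.card_subtype, Finset.filter_true_of_mem hTl]
  rw [hcard]
  -- An embedding of `l` outside the restrictions of `B` has no extension to `k` lying in `B`, so
  -- the conjugates of `x` above it are on the circle.
  refine h l L (B.image fun σ => σ.comp (algebraMap l k)) _ x' (Finset.card_image_le.trans hB)
    ?_ ?_ ?_ ?_ ?_
  · intro t ht
    rw [Finset.mem_subtype] at ht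
    rw [hx' t ht]
    intro h0
    exact (hx t ht).ne_zero (congrArg Subtype.val h0)
  · intro t ht
    rw [Finset.mem_subtype] at ht
    rw [hx' t ht]
    exact Subtype.ext (hx t ht).add_inv
  · intro t ht τ hτ
    rw [Finset.mem_subtype] at ht
    rw [hx' t ht]
    obtain ⟨τ', hτ'⟩ := exists_extension L τ
    rw [← hτ']
    refine (hx t ht).norm_eq_one τ' fun hB' => hτ ?_
    refine Finset.mem_image.mpr ⟨_, hB', ?_⟩
    ext s
    exact hτ' (φ s)
  · intro t ht
    rw [Finset.mem_subtype] at ht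
    rw [hx' t ht]
    refine logHeight₁_mul_le L _ ?_ (hx t ht).logMahler_le
    refine le_trans (le_of_eq ?_) (finrank_adjoin_le (hx t ht).add_inv)
    rw [hl t ht]
  · intro t ht m hm
    rw [Finset.mem_subtype] at ht
    rw [hx' t ht]
    intro h1
    exact hx1 t ht m hm (congrArg Subtype.val h1)

theorem pow_log_two_le_exp (d : ℕ) (hd : 0 < d) :
    ((d ^ Nat.log 2 d : ℕ) : ℝ) ≤ Real.exp (2 * Real.log d ^ 2) := by
  have hd' : (0 : ℝ) < d := by exact_mod_cast hd
  have h1 : (Nat.log 2 d : ℝ) * Real.log 2 ≤ Real.log d := by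
    rw [← Real.log_pow]
    apply Real.log_le_log (by positivity)
    exact_mod_cast Nat.pow_log_le_self 2 hd.ne'
  have h2 : (Nat.log 2 d : ℝ) ≤ 2 * Real.log d := by
    have h3 : (0 : ℝ) ≤ Nat.log 2 d := Nat.cast_nonneg _
    nlinarith [Real.log_two_gt_d9]
  have h4 : 0 ≤ Real.log d := Real.log_nonneg (by exact_mod_cast hd)
  have h5 : (d : ℝ) = Real.exp (Real.log d) := (Real.exp_log hd').symm
  push_cast
  calc (d : ℝ) ^ Nat.log 2 d = Real.exp (Nat.log 2 d * Real.log d) := by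
        conv_lhs => rw [h5]
        rw [← Real.exp_nat_mul]
    _ ≤ _ := Real.exp_le_exp.mpr (by nlinarith)

/-- The bound for all `t = x + x⁻¹` in `k` with `x` of bounded Mahler measure and with almost all
conjugates on the unit circle. -/
theorem exists_card_goodRoots_le (R : ℝ) (hR : 0 ≤ R) :
    ∃ C : ℝ, 0 < C ∧ ∀ (k : Type*) [Field k] [NumberField k] (B : Finset (k →+* ℂ)),
      B.card ≤ 4 → ∀ T : Finset k, (∀ t ∈ T, ∃ x, IsGoodRoot R B t x) →
      (T.card : ℝ) ≤ C * Real.exp (C * Real.log (Module.finrank ℚ k) ^ 2) := by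
  obtain ⟨C, hC, h⟩ := exists_card_le_of_adjoin_eq R hR
  -- The 3000 exceeds `1024 e`, which comes from the at most `1024 d⁴` values of `t` for which `x`
  -- is a root of unity.
  refine ⟨C + 3000, by positivity, fun k _ _ B hB T hT => ?_⟩
  classical
  choose! x hx using hT
  set d := Module.finrank ℚ k with hd
  have hd0 : 0 < d := Module.finrank_pos
  have hdR : (1 : ℝ) ≤ d := by exact_mod_cast hd0
  have hlog : 0 ≤ Real.log d := Real.log_nonneg hdR
  obtain ⟨hfin, hcard⟩ := card_intermediateField_le k
  have := Fintype.ofFinite (IntermediateField ℚ k)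
  have h1 : ((T.filter fun t => ∃ m : ℕ, 0 < m ∧ x t ^ m = 1).card : ℝ)
      ≤ 1024 * Real.exp (6 * Real.log d ^ 2 + 1) := by
    have h2 : (T.filter fun t => ∃ m : ℕ, 0 < m ∧ x t ^ m = 1).card
        ≤ (2 * (4 * d) ^ 2) ^ 2 := by
      refine le_trans ?_ (card_smallRootsOfUnity_le (AlgebraicClosure k) (2 * (4 * d) ^ 2))
      apply Finset.card_le_card_of_injOn x
      · intro t ht
        simp only [Finset.coe_filter, Set.mem_ofPred_eq] at ht
        obtain ⟨ht, m, hm, h1⟩ := ht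
        refine mem_smallRootsOfUnity hm h1 (natDegree_minpoly_le (hx t ht).ne_zero
          (hx t ht).ne_zero (hx t ht).add_inv (hx t ht).add_inv ?_)
        rw [sup_idem]
        exact IntermediateField.mem_adjoin_simple_self k (x t)
      · intro t ht s hs h
        simp only [Finset.coe_filter, Set.mem_ofPred_eq] at ht hs
        apply (algebraMap k (AlgebraicClosure k)).injective
        rw [(hx t ht.1).add_inv, (hx s hs.1).add_inv, h]
    calc ((T.filter fun t => ∃ m : ℕ, 0 < m ∧ x t ^ m = 1).card : ℝ)
        ≤ (((2 * (4 * d) ^ 2) ^ 2 : ℕ) : ℝ) := by exact_mod_cast h2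
      _ = 1024 * (d : ℝ) ^ 4 := by push_cast; ring
      _ = 1024 * Real.exp (4 * Real.log d) := by
          have h5 : (d : ℝ) = Real.exp (Real.log d) := (Real.exp_log (by linarith)).symm
          conv_lhs => rw [h5]
          rw [← Real.exp_nat_mul]
          norm_num
      _ ≤ _ := by gcongr; nlinarith [sq_nonneg (3 * Real.log d - 1)]
  have h2 : ((T.filter fun t => ¬ ∃ m : ℕ, 0 < m ∧ x t ^ m = 1).card : ℝ)
      ≤ Real.exp (2 * Real.log d ^ 2) * (C * Real.exp (C * Real.log d ^ 2)) := by
    set T' := T.filter fun t => ¬ ∃ m : ℕ, 0 < m ∧ x t ^ m = 1 with hT'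
    rw [Finset.card_eq_sum_card_fiberwise (f := fun t => IntermediateField.adjoin ℚ {t})
      (t := Finset.univ) (fun _ _ => Finset.mem_coe.mpr (Finset.mem_univ _))]
    push_cast
    calc ∑ l : IntermediateField ℚ k,
          ((T'.filter fun t => IntermediateField.adjoin ℚ {t} = l).card : ℝ)
        ≤ ∑ _l : IntermediateField ℚ k, C * Real.exp (C * Real.log d ^ 2) := by
          refine Finset.sum_le_sum fun l _ => ?_
          refine (h k B hB l _ x (fun t ht => (Finset.mem_filter.mp ht).2) (fun t ht => ?_)
            fun t ht m hm h1 => ?_).trans ?_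
          · exact hx t (Finset.mem_filter.mp (Finset.mem_filter.mp ht).1).1
          · exact (Finset.mem_filter.mp (Finset.mem_filter.mp ht).1).2 ⟨m, hm, h1⟩
          · have hl0 : 0 < Module.finrank ℚ l := Module.finrank_pos
            have hld : Module.finrank ℚ l ≤ d :=
              Nat.le_of_dvd hd0 ⟨_, (Module.finrank_mul_finrank ℚ l k).symm⟩
            have : Real.log (Module.finrank ℚ l) ≤ Real.log d :=
              Real.log_le_log (by exact_mod_cast hl0) (by exact_mod_cast hld)
            have : 0 ≤ Real.log (Module.finrank ℚ l) := Real.log_nonneg (by exact_mod_cast hl0)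
            gcongr
      _ = (Nat.card (IntermediateField ℚ k) : ℝ) * (C * Real.exp (C * Real.log d ^ 2)) := by
          rw [Finset.sum_const, nsmul_eq_mul, Nat.card_eq_fintype_card, Finset.card_univ]
      _ ≤ _ := by
          gcongr
          refine le_trans ?_ (pow_log_two_le_exp d hd0)
          exact_mod_cast hcard
  have h3 : (T.card : ℝ) = (T.filter fun t => ∃ m : ℕ, 0 < m ∧ x t ^ m = 1).card
      + (T.filter fun t => ¬ ∃ m : ℕ, 0 < m ∧ x t ^ m = 1).card := by
    exact_mod_cast (Finset.card_filter_add_card_filter_not _).symm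
  set E := Real.exp ((C + 3000) * Real.log d ^ 2) with hE
  have h4 : Real.exp (6 * Real.log d ^ 2 + 1) ≤ 2.72 * E := by
    rw [Real.exp_add, mul_comm]
    have : Real.exp (6 * Real.log d ^ 2) ≤ E := by
      rw [hE]; gcongr; linarith
    have := Real.exp_one_lt_d9
    gcongr
    linarith
  have h5 : Real.exp (2 * Real.log d ^ 2) * (C * Real.exp (C * Real.log d ^ 2)) ≤ C * E := by
    have : Real.exp (2 * Real.log d ^ 2) * (C * Real.exp (C * Real.log d ^ 2))
      = C * Real.exp ((C + 2) * Real.log d ^ 2) := by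
        rw [mul_left_comm, ← Real.exp_add]; ring_nf
    rw [this, hE]
    gcongr
    linarith
  have hE0 : 0 ≤ E := Real.exp_nonneg _
  rw [h3]
  nlinarith

/-! ### Reduced norm, and left and right multiplication, in coordinates. -/

section Quaternion

variable {k : Type*} [Field k] {a b : k}

/-- The reduced norm of a generalized quaternion. -/
def redNorm (x : ℍ[k, a, 0, b]) : k :=
  x.re ^ 2 - a * x.imI ^ 2 - b * x.imJ ^ 2 + a * b * x.imK ^ 2

theorem mul_star_eq_redNorm (x : ℍ[k, a, 0, b]) :
    x * star x = algebraMap k _ (redNorm x) := by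
  rw [QuaternionAlgebra.algebraMap_eq]
  ext <;> simp [redNorm] <;> ring

theorem star_mul_eq_redNorm (x : ℍ[k, a, 0, b]) :
    star x * x = algebraMap k _ (redNorm x) := by
  rw [QuaternionAlgebra.algebraMap_eq]
  ext <;> simp [redNorm] <;> ring

theorem redNorm_mul (x y : ℍ[k, a, 0, b]) : redNorm (x * y) = redNorm x * redNorm y := by
  simp [redNorm]
  ring

theorem redNorm_one : redNorm (1 : ℍ[k, a, 0, b]) = 1 := by
  simp [redNorm]

theorem re_inv_mul_redNorm {q r : ℍ[k, a, 0, b]} (h : q * r = 1) :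
    r.re * redNorm q = q.re := by
  have h1 : star q = redNorm q • r := by
    calc star q = star q * (q * r) := by rw [h, mul_one]
      _ = redNorm q • r := by rw [← mul_assoc, star_mul_eq_redNorm, Algebra.smul_def]
  have h2 := congrArg QuaternionAlgebra.re h1
  simp at h2
  rw [h2, mul_comm]

theorem redNorm_ne_zero_of_mul_eq_one {q r : ℍ[k, a, 0, b]} (h : q * r = 1) :
    redNorm q ≠ 0 := by
  intro h0
  have := congrArg redNorm h
  rw [redNorm_mul, h0, zero_mul, redNorm_one] at this
  exact zero_ne_one this

theorem isUnit_of_redNorm_ne_zero {x : ℍ[k, a, 0, b]} (h : redNorm x ≠ 0) : IsUnit x := by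
  refine ⟨⟨x, (redNorm x)⁻¹ • star x, ?_, ?_⟩, rfl⟩
  · rw [mul_smul_comm, mul_star_eq_redNorm, Algebra.algebraMap_eq_smul_one, smul_smul,
      inv_mul_cancel₀ h, one_smul]
  · rw [smul_mul_assoc, star_mul_eq_redNorm, Algebra.algebraMap_eq_smul_one, smul_smul,
      inv_mul_cancel₀ h, one_smul]

theorem basisOneIJK_apply (i : Fin 4) : QuaternionAlgebra.basisOneIJK a 0 b i =
    ![(⟨1, 0, 0, 0⟩ : ℍ[k, a, 0, b]), ⟨0, 1, 0, 0⟩, ⟨0, 0, 1, 0⟩, ⟨0, 0, 0, 1⟩] i := by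
  apply (QuaternionAlgebra.basisOneIJK a 0 b).repr.injective
  rw [Module.Basis.repr_self]
  ext j
  rw [QuaternionAlgebra.coe_basisOneIJK_repr]
  fin_cases i <;> fin_cases j <;> simp

theorem trace_mulLeft_mul_mulRight (q r : ℍ[k, a, 0, b]) :
    LinearMap.trace k _ (LinearMap.mulLeft k q * LinearMap.mulRight k r) = 4 * (q.re * r.re) := by
  rw [LinearMap.trace_eq_matrix_trace k (QuaternionAlgebra.basisOneIJK a 0 b), Matrix.trace]
  simp only [Fin.sum_univ_four, Matrix.diag_apply, LinearMap.toMatrix_apply,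
    QuaternionAlgebra.coe_basisOneIJK_repr, basisOneIJK_apply]
  simp
  ring

theorem det_mulLeft (q : ℍ[k, a, 0, b]) :
    LinearMap.det (LinearMap.mulLeft k q) = redNorm q ^ 2 := by
  rw [← LinearMap.det_toMatrix (QuaternionAlgebra.basisOneIJK a 0 b)]
  have : LinearMap.toMatrix (QuaternionAlgebra.basisOneIJK a 0 b)
      (QuaternionAlgebra.basisOneIJK a 0 b) (LinearMap.mulLeft k q) =
      !![q.re, a * q.imI, b * q.imJ, -a * b * q.imK;
        q.imI, q.re, b * q.imK, -b * q.imJ;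
        q.imJ, -a * q.imK, q.re, a * q.imI;
        q.imK, -q.imJ, q.imI, q.re] := by
    ext i j
    rw [LinearMap.toMatrix_apply, QuaternionAlgebra.coe_basisOneIJK_repr, basisOneIJK_apply]
    fin_cases i <;> fin_cases j <;> simp
  rw [this]
  simp [Matrix.det_succ_row_zero, Fin.sum_univ_succ, Fin.succAbove, redNorm]
  ring

theorem det_mulRight (q : ℍ[k, a, 0, b]) :
    LinearMap.det (LinearMap.mulRight k q) = redNorm q ^ 2 := by
  rw [← LinearMap.det_toMatrix (QuaternionAlgebra.basisOneIJK a 0 b)]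
  have : LinearMap.toMatrix (QuaternionAlgebra.basisOneIJK a 0 b)
      (QuaternionAlgebra.basisOneIJK a 0 b) (LinearMap.mulRight k q) =
      !![q.re, a * q.imI, b * q.imJ, -a * b * q.imK;
        q.imI, q.re, -b * q.imK, b * q.imJ;
        q.imJ, a * q.imK, q.re, -a * q.imI;
        q.imK, q.imJ, -q.imI, q.re] := by
    ext i j
    rw [LinearMap.toMatrix_apply, QuaternionAlgebra.coe_basisOneIJK_repr, basisOneIJK_apply]
    fin_cases i <;> fin_cases j <;> simp
  rw [this]
  simp [Matrix.det_succ_row_zero, Fin.sum_univ_succ, Fin.succAbove, redNorm]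
  ring

end Quaternion

theorem trace_and_det_of_aroots {k V : Type*} [Field k] [AddCommGroup V] [Module k V]
    [Module.Finite k V] (f : Module.End k V) {μ μ' : AlgebraicClosure k}
    (h : f.charpoly.aroots (AlgebraicClosure k) = {1, 1, μ, μ'}) :
    algebraMap k (AlgebraicClosure k) (LinearMap.trace k V f) = 2 + μ + μ' ∧
      algebraMap k (AlgebraicClosure k) (LinearMap.det f) = μ * μ' := by
  let B := Module.finBasis k V
  have hch : ((LinearMap.toMatrix B B f).map (algebraMap k (AlgebraicClosure k))).charpoly.roots =
      {1, 1, μ, μ'} := by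
    rw [Matrix.charpoly_map, LinearMap.charpoly_toMatrix]
    exact h
  constructor
  · rw [LinearMap.trace_eq_matrix_trace k B, AddMonoidHom.map_trace,
      Matrix.trace_eq_sum_roots_charpoly, hch]
    simp
    ring
  · rw [← LinearMap.det_toMatrix B, RingHom.map_det, RingHom.mapMatrix_apply,
      Matrix.det_eq_prod_roots_charpoly, hch]
    simp

/-! ### The nontrivial eigenvalues of `Ad γ`. -/

section Conjugation

variable {k D : Type*} [Field k] [Ring D] [Algebra k D] [Module.Finite k D] {a b : k}

/-- The trace of `Ad γ` minus two, as the quantity `4 (re q)² / nr q - 2`. -/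
def eigenTrace (q : ℍ[k, a, 0, b]) : k :=
  4 * q.re ^ 2 / redNorm q - 2

/-- `Ad γ` has determinant 1, so the last two eigenvalues are inverse to each other, and its trace
`4 re(q) re(q⁻¹) = 4 (re q)² / nr q` equals `2 + μ + μ⁻¹`. -/
theorem IsNontrivialEigenvalue.add_inv (e : D ≃ₐ[k] ℍ[k, a, 0, b]) {g : Dˣ}
    {μ : AlgebraicClosure k} (h : IsNontrivialEigenvalue (QuotientGroup.mk g : PD k D) μ) :
    μ ≠ 0 ∧ algebraMap k (AlgebraicClosure k) (eigenTrace (e g)) = μ + μ⁻¹ := by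
  obtain ⟨μ', h⟩ := h
  have hconj : e.toLinearEquiv.conj (Ad k D (QuotientGroup.mk g)) =
      LinearMap.mulLeft k (e g) * LinearMap.mulRight k (e (g⁻¹ : Dˣ)) := by
    ext1 x
    simp [Ad, conjEnd, LinearEquiv.conj_apply]
  have hqr : e g * e (g⁻¹ : Dˣ) = 1 := by rw [← map_mul, Units.mul_inv, map_one]
  have hn := redNorm_ne_zero_of_mul_eq_one hqr
  obtain ⟨h1, h2⟩ := trace_and_det_of_aroots _ h
  rw [← LinearMap.trace_conj' _ e.toLinearEquiv, hconj, trace_mulLeft_mul_mulRight] at h1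
  rw [← LinearMap.det_conj _ e.toLinearEquiv] at h2
  change algebraMap k (AlgebraicClosure k)
    (LinearMap.det (e.toLinearEquiv.conj (Ad k D (QuotientGroup.mk g)))) = _ at h2
  rw [hconj, map_mul, det_mulLeft, det_mulRight,
    ← mul_pow, ← redNorm_mul, hqr, redNorm_one, one_pow, map_one] at h2
  refine ⟨left_ne_zero_of_mul (h2 ▸ one_ne_zero), ?_⟩
  rw [← eq_inv_of_mul_eq_one_right h2.symm, eigenTrace, ← re_inv_mul_redNorm hqr]
  have : 4 * ((e (g⁻¹ : Dˣ)).re * redNorm (e g)) ^ 2 / redNorm (e g) =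
      4 * ((e g).re * (e (g⁻¹ : Dˣ)).re) := by
    rw [← re_inv_mul_redNorm hqr]
    field_simp
  rw [this, map_sub, h1, map_ofNat]
  ring

end Conjugation

/-! ### Conjugacy classes are determined by the trace. -/

section Conjugacy

variable {k D : Type*} [Field k] [Ring D] [Algebra k D] {a b : k}

/-- Since `x² = y²` is scalar, every `w = y v + v x` satisfies `w x = y w`. Some `v` must give an
invertible `w`, even in the split case: vanishing of all the norms at `1, i, j, ij, 1 + i, 1 + j, 1
+ ij` gives `x_r y_r = 0` and `x_r y_s = x_s y_r`, which forces `x = 0` or `y = 0`. -/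
theorem exists_isUnit_mul_eq_mul [CharZero k] (ha : a ≠ 0) (hb : b ≠ 0) {x y : ℍ[k, a, 0, b]}
    (hx : x.re = 0) (hy : y.re = 0) (hx0 : x ≠ 0) (hy0 : y ≠ 0)
    (hn : redNorm x = redNorm y) : ∃ w : ℍ[k, a, 0, b], IsUnit w ∧ w * x = y * w := by
  have key : ∀ v : ℍ[k, a, 0, b], (y * v + v * x) * x = y * (y * v + v * x) := by
    intro v
    have hx2 : x * x = - algebraMap k _ (redNorm x) := by
      rw [← mul_star_eq_redNorm, QuaternionAlgebra.star_eq_neg.2 hx, mul_neg, neg_neg]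
    have hy2 : y * y = - algebraMap k _ (redNorm x) := by
      rw [hn, ← mul_star_eq_redNorm, QuaternionAlgebra.star_eq_neg.2 hy, mul_neg, neg_neg]
    rw [add_mul, mul_add, mul_assoc v x x, hx2, ← mul_assoc y y v, hy2, mul_neg, neg_mul,
      Algebra.commutes, add_comm, mul_assoc]
  by_contra! hcon
  have hz : ∀ v : ℍ[k, a, 0, b], redNorm (y * v + v * x) = 0 := by
    intro v
    by_contra h
    exact hcon _ (isUnit_of_redNorm_ne_zero h) (key v)
  obtain ⟨x0, x1, x2, x3⟩ := x
  obtain ⟨y0, y1, y2, y3⟩ := y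
  simp only at hx hy
  subst hx hy
  have e1 := hz ⟨1, 0, 0, 0⟩
  have e2 := hz ⟨0, 1, 0, 0⟩
  have e3 := hz ⟨0, 0, 1, 0⟩
  have e4 := hz ⟨0, 0, 0, 1⟩
  have e5 := hz ⟨1, 1, 0, 0⟩
  have e6 := hz ⟨1, 0, 1, 0⟩
  have e7 := hz ⟨1, 0, 0, 1⟩
  simp [redNorm] at e1 e2 e3 e4 e5 e6 e7 hn
  have p1 : x1 = 0 ∨ y1 = 0 := by
    have : (8 * a ^ 2 * b) * (x1 * y1) = 0 := by
      linear_combination (-a * b) * e1 + b * e2 - a * e3 + e4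
    simpa [ha, hb] using this
  have p2 : x2 = 0 ∨ y2 = 0 := by
    have : (8 * a * b ^ 2) * (x2 * y2) = 0 := by
      linear_combination (-a * b) * e1 - b * e2 + a * e3 + e4
    simpa [ha, hb] using this
  have p3 : x3 = 0 ∨ y3 = 0 := by
    have : (8 * a ^ 2 * b ^ 2) * (x3 * y3) = 0 := by
      linear_combination (a * b) * e1 + b * e2 + a * e3 + e4
    simpa [ha, hb] using this
  have c1 : x2 * y3 = x3 * y2 := by
    have : (4 * a * b) * (x2 * y3 - x3 * y2) = 0 := by
      linear_combination e5 - e1 - e2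
    simpa [ha, hb, sub_eq_zero] using this
  have c2 : x1 * y3 = x3 * y1 := by
    have : (4 * a * b) * (x1 * y3 - x3 * y1) = 0 := by
      linear_combination e1 + e3 - e6
    simpa [ha, hb, sub_eq_zero] using this
  have c3 : x1 * y2 = x2 * y1 := by
    have : (4 * a * b) * (x1 * y2 - x2 * y1) = 0 := by
      linear_combination e7 - e1 - e4
    simpa [ha, hb, sub_eq_zero] using this
  have hx0' : ¬ (x1 = 0 ∧ x2 = 0 ∧ x3 = 0) := by
    rintro ⟨rfl, rfl, rfl⟩
    exact hx0 rfl
  have hy0' : ¬ (y1 = 0 ∧ y2 = 0 ∧ y3 = 0) := by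
    rintro ⟨rfl, rfl, rfl⟩
    exact hy0 rfl
  clear hz hcon key e1 e2 e3 e4 e5 e6 e7 hn hx0 hy0
  grind

/-- Two non-scalar quaternions with the same trace and norm are conjugate. -/
theorem isConj_of_re_eq [CharZero k] (ha : a ≠ 0) (hb : b ≠ 0) {p q : ℍ[k, a, 0, b]ˣ}
    (hre : (p : ℍ[k, a, 0, b]).re = (q : ℍ[k, a, 0, b]).re)
    (hn : redNorm (p : ℍ[k, a, 0, b]) = redNorm (q : ℍ[k, a, 0, b]))
    (hp : (p : ℍ[k, a, 0, b]).im ≠ 0) (hq : (q : ℍ[k, a, 0, b]).im ≠ 0) : IsConj p q := by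
  obtain ⟨w, hw, hwx⟩ := exists_isUnit_mul_eq_mul ha hb (x := (p : ℍ[k, a, 0, b]).im)
    (y := (q : ℍ[k, a, 0, b]).im) rfl rfl hp hq (by
      simp [redNorm] at hn ⊢
      rw [hre] at hn
      linear_combination hn)
  refine isConj_iff.2 ⟨hw.unit, mul_inv_eq_iff_eq_mul.2 (Units.ext ?_)⟩
  simp only [Units.val_mul, IsUnit.unit_spec]
  rw [← QuaternionAlgebra.re_add_im (p : ℍ[k, a, 0, b]),
    ← QuaternionAlgebra.re_add_im (q : ℍ[k, a, 0, b]), mul_add, add_mul, hwx, hre,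
    QuaternionAlgebra.coe_commutes]

theorem mk_units_smul (c : kˣ) (g : Dˣ) :
    (QuotientGroup.mk (Units.map (algebraMap k D : k →* D) c * g) : PD k D) =
      QuotientGroup.mk g := by
  have h : Units.map (algebraMap k D : k →* D) c ∈ scalars k D := ⟨c, rfl⟩
  rw [QuotientGroup.mk_mul, (QuotientGroup.eq_one_iff _).2 h, one_mul]

theorem mk_eq_one_of_im_eq_zero (e : D ≃ₐ[k] ℍ[k, a, 0, b]) {g : Dˣ} (h : (e g).im = 0) :
    (QuotientGroup.mk g : PD k D) = 1 := by
  have h1 : e g = algebraMap k _ (e g).re := by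
    rw [← QuaternionAlgebra.re_add_im (e g), h]
    simp [QuaternionAlgebra.coe_algebraMap]
  have h0 : (e g).re ≠ 0 := by
    intro h0
    rw [h0, map_zero, EmbeddingLike.map_eq_zero_iff] at h1
    have : Nontrivial D := e.toEquiv.nontrivial
    exact g.ne_zero h1
  refine (QuotientGroup.eq_one_iff _).2 ⟨Units.mk0 _ h0, Units.ext (e.injective ?_)⟩
  simp [← h1]

/-- An element of `PDˣ(k)` which is represented by a pure quaternion has order two. -/
theorem orderOf_eq_two_of_re_eq_zero [CharZero k] (e : D ≃ₐ[k] ℍ[k, a, 0, b]) {g : Dˣ}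
    (h : (e g).re = 0) : orderOf (QuotientGroup.mk g : PD k D) = 2 := by
  have hqr : e g * e (g⁻¹ : Dˣ) = 1 := by rw [← map_mul, Units.mul_inv, map_one]
  have hn := redNorm_ne_zero_of_mul_eq_one hqr
  have : Fact (Nat.Prime 2) := ⟨Nat.prime_two⟩
  refine orderOf_eq_prime ?_ ?_
  · rw [← QuotientGroup.mk_pow]
    refine (QuotientGroup.eq_one_iff _).2 ⟨Units.mk0 _ (neg_ne_zero.2 hn), Units.ext
      (e.injective ?_)⟩
    have := mul_star_eq_redNorm (e g)
    rw [QuaternionAlgebra.star_eq_neg.2 h] at this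
    simp [pow_two, ← this]
  · rw [Ne, QuotientGroup.eq_one_iff]
    rintro ⟨c, hc⟩
    have h1 : e g = algebraMap k _ (c : k) := by
      rw [← hc]
      simp
    rw [h1, QuaternionAlgebra.algebraMap_eq] at h
    exact c.ne_zero h

/-- Away from the identity and the elements of order two, the trace of `Ad γ` determines the
conjugacy class of `γ`. -/
theorem isConj_of_eigenTrace_eq [CharZero k] (ha : a ≠ 0) (hb : b ≠ 0) (e : D ≃ₐ[k] ℍ[k, a, 0, b])
    {g h : Dˣ} (hg : orderOf (QuotientGroup.mk g : PD k D) ≠ 2)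
    (hh : orderOf (QuotientGroup.mk h : PD k D) ≠ 2)
    (hg1 : (QuotientGroup.mk g : PD k D) ≠ 1) (hh1 : (QuotientGroup.mk h : PD k D) ≠ 1)
    (ht : eigenTrace (e g) = eigenTrace (e h)) :
    IsConj (QuotientGroup.mk g : PD k D) (QuotientGroup.mk h) := by
  have hg0 : (e g).re ≠ 0 := fun h0 ↦ hg (orderOf_eq_two_of_re_eq_zero e h0)
  have hh0 : (e h).re ≠ 0 := fun h0 ↦ hh (orderOf_eq_two_of_re_eq_zero e h0)
  have hnz : ∀ u : Dˣ, redNorm (e u) ≠ 0 := fun u ↦ redNorm_ne_zero_of_mul_eq_one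
    (show e u * e (u⁻¹ : Dˣ) = 1 by rw [← map_mul, Units.mul_inv, map_one])
  have hng := hnz g
  have hnh := hnz h
  -- Rescaling the lift equalises the real parts, and equal `eigenTrace` then equalises the norms.
  -- This needs nonzero real parts, which is where order two is excluded.
  let c : kˣ := Units.mk0 ((e g).re / (e h).re) (div_ne_zero hg0 hh0)
  rw [← mk_units_smul c h]
  set h' := Units.map (algebraMap k D : k →* D) c * h with hh'
  have hval : e h' = (c : k) • e h := by
    simp [hh', Algebra.smul_def]
  have hconj : IsConj (Units.map (e : D →* ℍ[k, a, 0, b]) g)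
      (Units.map (e : D →* ℍ[k, a, 0, b]) h') := by
    refine isConj_of_re_eq ha hb ?_ ?_ ?_ ?_
    · simp only [Units.coe_map, MonoidHom.coe_coe, hval, QuaternionAlgebra.re_smul]
      simp [c, hh0]
    · simp only [Units.coe_map, MonoidHom.coe_coe, hval]
      have : redNorm ((c : k) • e h) = (c : k) ^ 2 * redNorm (e h) := by
        simp [redNorm]
        ring
      rw [this]
      simp only [eigenTrace, sub_left_inj] at ht
      rw [div_eq_div_iff hng hnh] at ht
      simp only [c, Units.val_mk0]
      field_simp
      have h4 : (4 : k) ≠ 0 := by norm_num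
      refine mul_left_cancel₀ h4 ?_
      linear_combination -ht
    · exact fun h0 ↦ hg1 (mk_eq_one_of_im_eq_zero e h0)
    · simp only [Units.coe_map, MonoidHom.coe_coe]
      intro h0
      refine hh1 ?_
      rw [← mk_units_smul c h]
      exact mk_eq_one_of_im_eq_zero e h0
  have := (Units.mapEquiv (e.symm : ℍ[k, a, 0, b] ≃* D)).toMonoidHom.map_isConj hconj
  have h2 := (QuotientGroup.mk' (scalars k D)).map_isConj this
  convert h2 using 1
  · congr 1
    ext
    simp
  · congr 1
    ext
    simp

end Conjugacy

/-! ### Real places: splitting criterion and compactness. -/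

section Splitting

/-- The matrices `diag (s, -s)` and `!![0, b; 1, 0]` generate a copy of `(s², b)`. -/
def matrixBasis {k F : Type*} [Field k] [Field F] [Algebra k F] {a : k} (b : k) {s : F}
    (hs : s ^ 2 = algebraMap k F a) :
    QuaternionAlgebra.Basis (Matrix (Fin 2) (Fin 2) F) a 0 b where
  i := !![s, 0; 0, -s]
  j := !![0, algebraMap k F b; 1, 0]
  k := !![0, s * algebraMap k F b; -s, 0]
  i_mul_i := by
    ext i j
    fin_cases i <;> fin_cases j <;> simp <;> simp [Algebra.smul_def, ← hs, pow_two]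
  j_mul_j := by
    ext i j
    fin_cases i <;> fin_cases j <;> simp [Algebra.algebraMap_eq_smul_one]
  i_mul_j := by
    ext i j
    fin_cases i <;> fin_cases j <;> simp
  j_mul_i := by
    ext i j
    fin_cases i <;> fin_cases j <;> simp <;> rw [Algebra.smul_def, mul_comm]

/-- The matrices of `matrixBasis` span `M₂(F)`, as explicit preimages show, and equality of
dimensions gives injectivity. -/
theorem nonempty_algEquiv_matrix_of_sq {k F : Type*} [Field k] [Field F] [CharZero F] [Algebra k F]
    {a b : k} (ha : a ≠ 0) (hb : b ≠ 0) {s : F} (hs : s ^ 2 = algebraMap k F a) :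
    Nonempty ((F ⊗[k] ℍ[k, a, 0, b]) ≃ₐ[F] Matrix (Fin 2) (Fin 2) F) := by
  have hs0 : s ≠ 0 := by
    rintro rfl
    rw [zero_pow two_ne_zero, eq_comm, map_eq_zero] at hs
    exact ha hs
  have hb0 : algebraMap k F b ≠ 0 := by rwa [Ne, map_eq_zero]
  let B := matrixBasis b hs
  let f : F ⊗[k] ℍ[k, a, 0, b] →ₐ[F] Matrix (Fin 2) (Fin 2) F :=
    Algebra.TensorProduct.lift (Algebra.ofId F _) B.liftHom
      fun x y ↦ Algebra.commutes x (B.liftHom y)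
  have hf : ∀ (x : F) (y : ℍ[k, a, 0, b]), f (x ⊗ₜ y) = x • B.lift y := by
    intro x y
    rw [Algebra.smul_def]
    exact Algebra.TensorProduct.lift_tmul _ _ _ _ _
  have hsurj : Function.Surjective f := by
    intro M
    refine ⟨((M 0 0 + M 1 1) / 2) ⊗ₜ ⟨1, 0, 0, 0⟩ + ((M 0 0 - M 1 1) / (2 * s)) ⊗ₜ ⟨0, 1, 0, 0⟩ +
      ((M 0 1 / algebraMap k F b + M 1 0) / 2) ⊗ₜ ⟨0, 0, 1, 0⟩ +
      ((M 0 1 / algebraMap k F b - M 1 0) / (2 * s)) ⊗ₜ ⟨0, 0, 0, 1⟩, ?_⟩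
    simp only [map_add, hf]
    ext i j
    fin_cases i <;> fin_cases j <;>
      simp [QuaternionAlgebra.Basis.lift, B, matrixBasis] <;> field_simp <;> ring
  have hfin : Module.finrank F (F ⊗[k] ℍ[k, a, 0, b]) =
      Module.finrank F (Matrix (Fin 2) (Fin 2) F) := by
    rw [Module.finrank_baseChange, QuaternionAlgebra.finrank_eq_four, Module.finrank_matrix]
    simp
  have hinj : Function.Injective f :=
    (LinearMap.injective_iff_surjective_of_finrank_eq_finrank hfin (f := f.toLinearMap)).2 hsurj
  exact ⟨AlgEquiv.ofBijective f ⟨hinj, hsurj⟩⟩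

variable {k D : Type*} [Field k] [CharZero k] [Ring D] [Algebra k D] {a b : k}

theorem splitsAt_of_pos (e : D ≃ₐ[k] ℍ[k, a, 0, b]) (ha : a ≠ 0) (hb : b ≠ 0)
    {v : InfinitePlace k} (hv : v.IsReal) (h : 0 < v.embedding_of_isReal hv a) :
    SplitsAt D v := by
  let E := InfinitePlace.Completion.ringEquivRealOfIsReal hv
  have hs : (E.symm (√(v.embedding_of_isReal hv a))) ^ 2 = algebraMap k v.Completion a := by
    apply E.injective
    rw [map_pow, E.apply_symm_apply, Real.sq_sqrt h.le]
    exact (InfinitePlace.Completion.extensionEmbeddingOfIsReal_coe hv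
      ((WithAbs.equiv v.1).symm a)).symm
  have : CharZero v.Completion := charZero_of_injective_algebraMap (algebraMap k v.Completion).injective
  obtain ⟨φ⟩ := nonempty_algEquiv_matrix_of_sq ha hb hs
  exact ⟨(Algebra.TensorProduct.congr AlgEquiv.refl e).trans φ⟩

/-- At a real place where `D` does not split, both `a` and `b` are negative. -/
theorem neg_of_not_splitsAt (e : D ≃ₐ[k] ℍ[k, a, 0, b]) (ha : a ≠ 0) (hb : b ≠ 0)
    {v : InfinitePlace k} (hv : v.IsReal) (h : ¬ SplitsAt D v) :
    v.embedding_of_isReal hv a < 0 ∧ v.embedding_of_isReal hv b < 0 := by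
  constructor
  · refine lt_of_le_of_ne (not_lt.1 fun h0 ↦ h (splitsAt_of_pos e ha hb hv h0)) ?_
    rwa [Ne, map_eq_zero]
  · refine lt_of_le_of_ne (not_lt.1 fun h0 ↦ h
      (splitsAt_of_pos (e.trans (QuaternionAlgebra.swapEquiv a b)) hb ha hv h0)) ?_
    rwa [Ne, map_eq_zero]

/-- The real quadratic `z² - t z + 1` has discriminant `t² - 4 ≤ 0`, so its roots are conjugate with
product 1. -/
theorem norm_eq_one_of_add_inv_eq {z : ℂ} (hz : z ≠ 0) {t : ℝ} (ht : (t : ℂ) = z + z⁻¹)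
    (h1 : -2 ≤ t) (h2 : t ≤ 2) : ‖z‖ = 1 := by
  have e : z * z - t * z + 1 = 0 := by
    rw [ht]
    field_simp
    ring
  have hre := congrArg Complex.re e
  have him := congrArg Complex.im e
  simp at hre him
  have key : z.re ^ 2 + z.im ^ 2 = 1 := by
    by_cases h0 : z.im = 0
    · rw [h0] at hre ⊢
      have h4 : (z.re - t / 2) ^ 2 = 0 :=
        le_antisymm (by nlinarith) (sq_nonneg _)
      have h5 : z.re = t / 2 := sub_eq_zero.1 (pow_eq_zero_iff two_ne_zero |>.1 h4)
      have : t = 2 * z.re := by linarith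
      subst this
      nlinarith
    · have : t = 2 * z.re := by
        have : z.im * (2 * z.re - t) = 0 := by linarith
        rcases mul_eq_zero.1 this with h | h
        · exact absurd h h0
        · linarith
      subst this
      nlinarith
  rw [← sq_eq_sq₀ (norm_nonneg _) zero_le_one, Complex.sq_norm, Complex.normSq_apply]
  linarith

/-- For `a, b < 0` the norm is a sum of nonnegative terms, one of them `(re q)²`, so `0 ≤ (re q)² /
nr q ≤ 1`. -/
theorem eigenTrace_mem_Icc (φ : k →+* ℝ) (ha : φ a < 0) (hb : φ b < 0) {q : ℍ[k, a, 0, b]}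
    (hq : redNorm q ≠ 0) : -2 ≤ φ (eigenTrace q) ∧ φ (eigenTrace q) ≤ 2 := by
  have hn : φ (redNorm q) = φ q.re ^ 2 + (-φ a) * φ q.imI ^ 2 + (-φ b) * φ q.imJ ^ 2 +
      (-φ a) * (-φ b) * φ q.imK ^ 2 := by
    simp [redNorm]
    ring
  have h1 : 0 ≤ (-φ a) * φ q.imI ^ 2 := mul_nonneg (by linarith) (sq_nonneg _)
  have h2 : 0 ≤ (-φ b) * φ q.imJ ^ 2 := mul_nonneg (by linarith) (sq_nonneg _)
  have h3 : 0 ≤ (-φ a) * (-φ b) * φ q.imK ^ 2 :=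
    mul_nonneg (mul_nonneg (by linarith) (by linarith)) (sq_nonneg _)
  have h4 : φ q.re ^ 2 ≤ φ (redNorm q) := by linarith
  have h5 : 0 < φ (redNorm q) := lt_of_le_of_ne ((sq_nonneg _).trans h4)
    (by rwa [Ne, eq_comm, map_eq_zero])
  have ht : φ (eigenTrace q) = 4 * φ q.re ^ 2 / φ (redNorm q) - 2 := by
    simp only [eigenTrace, map_sub, map_div₀, map_mul, map_pow, map_ofNat]
  rw [ht]
  constructor
  · have : 0 ≤ 4 * φ q.re ^ 2 / φ (redNorm q) := by positivity
    linarith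
  · have : 4 * φ q.re ^ 2 / φ (redNorm q) ≤ 4 := by
      rw [div_le_iff₀ h5]
      linarith
    linarith

end Splitting

/-! ### Admissible algebras: from conjugacy classes to values of `t`. -/

section Admissible

variable {k : Type*} [Field k] [NumberField k] (D : Type*) [Ring D] [Algebra k D]

open scoped Classical in
/-- The complex embeddings of `k` at which `PDˣ` is not compact, together with the non-real ones. -/
def noncompactEmbeddings : Finset (k →+* ℂ) :=
  Finset.univ.filter fun σ ↦
    InfinitePlace.IsComplex (InfinitePlace.mk σ) ∨ SplitsAt D (InfinitePlace.mk σ)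

variable {D}

-- One split place and at most one complex place, with at most two embeddings each.
open scoped Classical in
theorem card_noncompactEmbeddings_le (h : IsAdmissible k D) :
    (noncompactEmbeddings (k := k) D).card ≤ 4 := by
  obtain ⟨v, hv, huniq⟩ := h.existsUnique_splitsAt
  have hmult : ∀ w : InfinitePlace k,
      (Finset.univ.filter fun σ : k →+* ℂ ↦ InfinitePlace.mk σ = w).card ≤ 2 := by
    intro w
    rw [InfinitePlace.card_filter_mk_eq, InfinitePlace.mult]
    split_ifs <;> norm_num
  have hc : (Finset.univ.filter fun w : InfinitePlace k ↦ w.IsComplex).card ≤ 1 := by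
    have := h.complexPlaces_le_one
    rwa [InfinitePlace.nrComplexPlaces, Fintype.card_subtype] at this
  have hsub : noncompactEmbeddings (k := k) D ⊆
      (insert v (Finset.univ.filter fun w : InfinitePlace k ↦ w.IsComplex)).biUnion
        fun w ↦ Finset.univ.filter fun σ : k →+* ℂ ↦ InfinitePlace.mk σ = w := by
    intro σ hσ
    simp only [noncompactEmbeddings, Finset.mem_filter, Finset.mem_univ, true_and] at hσ
    simp only [Finset.mem_biUnion, Finset.mem_filter, Finset.mem_univ, true_and,
      Finset.mem_insert, exists_eq_right']
    rcases hσ with h1 | h1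
    · exact Or.inr h1
    · exact Or.inl (huniq _ h1)
  calc _ ≤ _ := Finset.card_le_card hsub
    _ ≤ _ := Finset.card_biUnion_le_card_mul _ _ 2 fun w _ ↦ hmult w
    _ ≤ 2 * 2 := Nat.mul_le_mul_right _ ((Finset.card_insert_le _ _).trans (by omega))

theorem isGoodRoot_of_isNontrivialEigenvalue [Module.Finite k D] {a b : k} (ha : a ≠ 0)
    (hb : b ≠ 0) (e : D ≃ₐ[k] ℍ[k, a, 0, b]) {R : ℝ} {g : Dˣ} {μ : AlgebraicClosure k}
    (hμ : IsNontrivialEigenvalue (QuotientGroup.mk g : PD k D) μ) (hR : logMahler μ ≤ R) :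
    IsGoodRoot R (noncompactEmbeddings (k := k) D) (eigenTrace (e g)) μ := by
  obtain ⟨h0, hadd⟩ := hμ.add_inv e
  refine ⟨h0, hadd, hR, fun τ hτ ↦ ?_⟩
  simp only [noncompactEmbeddings, Finset.mem_filter, Finset.mem_univ, true_and, not_or] at hτ
  obtain ⟨h1, h2⟩ := hτ
  set σ := τ.comp (algebraMap k (AlgebraicClosure k)) with hσ
  have hreal : (InfinitePlace.mk σ).IsReal := InfinitePlace.not_isComplex_iff_isReal.1 h1
  obtain ⟨na, nb⟩ := neg_of_not_splitsAt e ha hb hreal h2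
  have hq : redNorm (e g) ≠ 0 := redNorm_ne_zero_of_mul_eq_one
    (show e g * e (g⁻¹ : Dˣ) = 1 by rw [← map_mul, Units.mul_inv, map_one])
  obtain ⟨l, u⟩ := eigenTrace_mem_Icc _ na nb hq
  refine norm_eq_one_of_add_inv_eq (by rwa [Ne, map_eq_zero]) ?_ l u
  rw [InfinitePlace.embedding_of_isReal_apply, InfinitePlace.embedding_mk_eq_of_isReal
    (InfinitePlace.isReal_mk_iff.1 hreal), hσ, RingHom.comp_apply, hadd, map_add, map_inv₀]

/-- A set all of whose finite subsets have at most `M` elements is finite with at most `M`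
elements. -/
theorem finite_and_ncard_le {α : Type*} {s : Set α} {M : ℝ}
    (h : ∀ t : Finset α, (t : Set α) ⊆ s → (t.card : ℝ) ≤ M) : s.Finite ∧ (s.ncard : ℝ) ≤ M := by
  have hfin : s.Finite := by
    by_contra hinf
    obtain ⟨n, hn⟩ := exists_nat_gt M
    obtain ⟨t, hts, hcard⟩ := Set.Infinite.exists_subset_card_eq hinf n
    have := h t hts
    rw [hcard] at this
    linarith
  refine ⟨hfin, ?_⟩
  rw [Set.ncard_eq_toFinset_card _ hfin]
  exact h _ (by simp)

theorem card_le_of_subset_boundedClasses [Module.Finite k D] (hD : IsAdmissible k D) {R M : ℝ}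
    (hM : ∀ T : Finset k,
      (∀ t ∈ T, ∃ x, IsGoodRoot R (noncompactEmbeddings (k := k) D) t x) → (T.card : ℝ) ≤ M)
    {S : Finset (ConjClasses (PD k D))} (hS : (S : Set (ConjClasses (PD k D))) ⊆
      boundedClasses k D R) : (S.card : ℝ) ≤ M + 1 := by
  classical
  obtain ⟨a, b, ha, hb, ⟨e⟩⟩ := hD.isQuaternionAlgebra
  have hrep : ∀ c ∈ S, ∃ g : Dˣ, ConjClasses.mk (QuotientGroup.mk g : PD k D) = c ∧
      orderOf (QuotientGroup.mk g : PD k D) ≠ 2 ∧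
      ∃ x, IsGoodRoot R (noncompactEmbeddings (k := k) D) (eigenTrace (e g)) x := by
    intro c hc
    obtain ⟨γ, hγ, ho, μ, hμ, hR⟩ := hS hc
    obtain ⟨g, rfl⟩ := QuotientGroup.mk_surjective γ
    exact ⟨g, hγ, ho, μ, isGoodRoot_of_isNontrivialEigenvalue ha hb e hμ hR⟩
  choose! g hg ho x hx using hrep
  -- The identity has `eigenTrace` 2, as do nontrivial unipotent classes when they exist, so it is
  -- set aside; this accounts for the `+ 1`.
  let S' := S.erase (ConjClasses.mk 1)
  have hinj : Set.InjOn (fun c ↦ eigenTrace (e (g c))) S' := by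
    intro c hc c' hc' heq
    obtain ⟨hc1, hcS⟩ := Finset.mem_erase.1 hc
    obtain ⟨hc1', hcS'⟩ := Finset.mem_erase.1 hc'
    rw [← hg c hcS, ← hg c' hcS', ConjClasses.mk_eq_mk_iff_isConj]
    refine isConj_of_eigenTrace_eq ha hb e (ho c hcS) (ho c' hcS') ?_ ?_ heq
    · intro h1
      exact hc1 (by rw [← hg c hcS, h1])
    · intro h1
      exact hc1' (by rw [← hg c' hcS', h1])
  have h1 := hM (S'.image fun c ↦ eigenTrace (e (g c))) (by
    intro t ht
    obtain ⟨c, hc, rfl⟩ := Finset.mem_image.1 ht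
    exact ⟨x c, hx c (Finset.mem_of_mem_erase hc)⟩)
  rw [Finset.card_image_of_injOn hinj] at h1
  have h2 : S.card ≤ S'.card + 1 := by
    have : S.card - 1 ≤ S'.card := Finset.pred_card_le_card_erase
    omega
  have h3 : (S.card : ℝ) ≤ S'.card + 1 := by exact_mod_cast h2
  linarith

end Admissible

end QuatConj

end

theorem theoremt (R : ℝ) (hR : 0 < R) :
    ∃ C : ℝ, 0 < C ∧ ∀ (k : Type*) [Field k] [NumberField k] (D : Type*) [Ring D] [Algebra k D]
      [Module.Finite k D], QuatConj.IsAdmissible k D →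
        (QuatConj.boundedClasses k D R).Finite ∧
        ((QuatConj.boundedClasses k D R).ncard : ℝ) ≤
          C * Real.exp (C * Real.log (Module.finrank ℚ k) ^ 2) := by
  obtain ⟨C, hC, h⟩ := QuatConj.exists_card_goodRoots_le R hR.le
  refine ⟨C + 1, by linarith, fun k _ _ D _ _ _ hD ↦ ?_⟩
  have hle : C * Real.exp (C * Real.log (Module.finrank ℚ k) ^ 2) + 1 ≤
      (C + 1) * Real.exp ((C + 1) * Real.log (Module.finrank ℚ k) ^ 2) := by
    have h0 : 0 ≤ Real.log (Module.finrank ℚ k) ^ 2 := sq_nonneg _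
    have h1 : Real.exp (C * Real.log (Module.finrank ℚ k) ^ 2) ≤
        Real.exp ((C + 1) * Real.log (Module.finrank ℚ k) ^ 2) := by
      gcongr
      linarith
    have h2 : 1 ≤ Real.exp ((C + 1) * Real.log (Module.finrank ℚ k) ^ 2) :=
      Real.one_le_exp (by positivity)
    linarith [mul_le_mul_of_nonneg_left h1 hC.le]
  obtain ⟨hfin, hcard⟩ := QuatConj.finite_and_ncard_le fun S hS ↦
    QuatConj.card_le_of_subset_boundedClasses hD
      (h k _ (QuatConj.card_noncompactEmbeddings_le hD)) hS
  exact ⟨hfin, hcard.trans hle⟩
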